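/- **Setting.** Let $N$ sensors observe the linear system $$x_{k+1}=Fx_k+w_k,\qquad y_{i,k}=H_ix_k+v_{i,k}\quad(i=1,\dots,N),\qquad x_k\in\mathbb R^n,\ y_{i,k}\in\mathbb R^{m_i},$$ where $w_k,v_{i,k}$ are zero-mean, jointly Gaussian, white and mutually uncorrelated, with $\mathbb E\{w_kw_l^\top\}=Q\delta_{kl}$, $\mathbb E\{v_{i,k}v_{j,l}^\top\}=R_i\delta_{ij}\delta_{kl}$, $\mathbb E\{w_kv_{i,l}^\top\}=0$, $Q>0$, $R_i>0$; the initial state $x_0$ is Gaussian with covariance $P_0>0$ and is uncorrelated with the noises. Let $H=[H_1;\dots;H_N]$. The estimators communicate over an undirected graph with symmetric weights $a_{ij}$ ($a_{ij}>0$ on edges, $a_{ij}=0$ otherwise) and Laplacian $L=\operatorname{diag}(\sum_ja_{ij})-(a_{ij})$. **Algorithm (DA-DKF).** Parameters: gains $\alpha_{\lambda,i},\alpha_{\upsilon,i}>0$, constants $\epsilon_i>0$, and a number $l^*$ of subiterations. Let $\omega_i^\delta=\operatorname{vech}(H_i^\top R_i^{-1}H_i)$ (half-vectorization). Take arbitrary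 $\hat x_{i,0}\in\mathbb R^n$ and $P_{i,0}>0$, and set $\theta_{i,0,l^*}=\omega_i^\delta$, $\upsilon_{i,0,l^*}=0$. For $k=1,2,\dots$, every estimator $i$ puts $$\hat x_{i,k|k-1}=F\hat x_{i,k-1},\quad P_{i,k|k-1}=FP_{i,k-1}F^\top+Q,$$ $$\xi_{i,k,0}=\hat x_{i,k|k-1},\quad \lambda_{i,k,0}=0,\quad \theta_{i,k,0}=\theta_{i,k-1,l^*},\quad \upsilon_{i,k,0}=\upsilon_{i,k-1,l^*},$$ then, for $l=0,\dots,l^*-1$, $$\lambda_{i,k,l+1}=\lambda_{i,k,l}+\frac{\alpha_{\lambda,i}}{\|NP_{i,k|k-1}\|+\epsilon_i}\sum_ja_{ij}(\xi_{i,k,l}-\xi_{j,k,l}),$$ $$\xi_{i,k,l+1}=\hat x_{i,k|k-1}+K^{\mathsf{cons}}_{i,k}H_i^\top R_i^{-1}(y_{i,k}-H_i\hat x_{i,k|k-1})-K^{\mathsf{cons}}_{i,k}\sum_ja_{ij}(\lambda_{i,k,l+1}-\lambda_{j,k,l+1}),$$ $$\upsilon_{i,k,l+1}=\upsilon_{i,k,l}+\alpha_{\upsilon,i}\sum_ja_{ij}(\theta_{i,k,l}-\theta_{j,k,l}),\qquad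 \theta_{i,k,l+1}=N\omega_i^\delta-\sum_ja_{ij}(\upsilon_{i,k,l+1}-\upsilon_{j,k,l+1}),$$ where $K^{\mathsf{cons}}_{i,k}=(H_i^\top R_i^{-1}H_i+\frac1NP_{i,k|k-1}^{-1})^{-1}$ and $\|\cdot\|$ is the spectral norm, and finally $$\hat x_{i,k}=\xi_{i,k,l^*},\qquad P_{i,k}=(P_{i,k|k-1}^{-1}+\Theta_{i,k,l^*})^{-1},\qquad \Theta_{i,k,l^*}=\operatorname{vech}^{-1}(\theta_{i,k,l^*}).$$ **Theorem.** Suppose that $(F,H)$ is observable, that the graph is connected, and that every eigenvalue of $L$ is at most $\bar\sigma$, where $\bar\sigma>0$. If $0<\alpha_{\lambda,i}<2/\bar\sigma^2$ and $0<\alpha_{\upsilon,i}<2/\bar\sigma^2$ for all $i$, then there is $\bar l^*$ such that for every $l^*\ge\bar l^*$ and all initial values $\hat x_{i,0}$, $P_{i,0}>0$, the algorithm is well defined, with $P_{i,k}>0$ for all $i$ and $k$; the errors $x_k-\xi_{i,k,l^*}$, $k\ge1$, are integrable; and $$\lim_{k\to\infty}\mathbb E\{x_k-\xi_{i,k,l^*}\}=0\qquad\text{for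 every }i=1,\dots,N.$$ -/

import Mathlib

open MeasureTheory ProbabilityTheory Filter Topology
open scoped Matrix

namespace DADKF

/-! ### System, network, gains -/

/-- Data of the linear system `x_{k+1} = F x_k + w_k`, `y_{i,k} = H_i x_k + v_{i,k}`, with `N` sensors,
state dimension `n`, output dimensions `m i`, and noise covariances `Q` and `R i`. -/
structure LinSystem (N n : ℕ) (m : Fin N → ℕ) where
  F : Matrix (Fin n) (Fin n) ℝ
  H : ∀ i, Matrix (Fin (m i)) (Fin n) ℝ
  Q : Matrix (Fin n) (Fin n) ℝ
  R : ∀ i, Matrix (Fin (m i)) (Fin (m i)) ℝ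

namespace LinSystem

variable {N n : ℕ} {m : Fin N → ℕ}

/-- The stacked output matrix `H = [H_1; …; H_N]`. -/
def stackedH (S : LinSystem N n m) : Matrix (Σ i, Fin (m i)) (Fin n) ℝ :=
  Matrix.of fun p a => S.H p.1 p.2 a

/-- The observability matrix `[H; H F; …; H F^(n-1)]`. -/
def obsMatrix (S : LinSystem N n m) : Matrix (Fin n × (Σ i, Fin (m i))) (Fin n) ℝ :=
  Matrix.of fun p a => (S.stackedH * S.F ^ (p.1 : ℕ)) p.2 a

/-- The pair `(F, H)` is observable: the observability matrix has full column rank. -/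
def Observable (S : LinSystem N n m) : Prop := S.obsMatrix.rank = n

end LinSystem

/-- An undirected communication graph on the `N` estimators, with symmetric edge weights `a_ij` that are
positive on edges and zero elsewhere. -/
structure Network (N : ℕ) where
  graph : SimpleGraph (Fin N)
  weight : Matrix (Fin N) (Fin N) ℝ
  weight_symm : ∀ i j, weight i j = weight j i
  weight_pos : ∀ i j, graph.Adj i j → 0 < weight i j
  weight_zero : ∀ i j, ¬ graph.Adj i j → weight i j = 0

namespace Network

variable {N : ℕ}

/-- The weighted graph Laplacian `L`. -/
def laplacian (G : Network N) : Matrix (Fin N) (Fin N) ℝ :=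
  Matrix.diagonal (fun i => ∑ j, G.weight i j) - G.weight

/-- `∑_{j ∈ N_i} a_ij (z_i - z_j)`. The weights vanish off the edges, so the sum may run over all `j`. -/
def disagreement {V : Type*} [AddCommGroup V] [Module ℝ V] (G : Network N) (z : Fin N → V)
    (i : Fin N) : V :=
  ∑ j, G.weight i j • (z i - z j)

/-- The blockwise Laplacian `(L ⊗ I) z` is the vector of local disagreements. -/
theorem disagreement_eq_laplacian {V : Type*} [AddCommGroup V] [Module ℝ V] (G : Network N)
    (z : Fin N → V) (i : Fin N) : G.disagreement z i = ∑ j, G.laplacian i j • z j := by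
  simp only [disagreement, laplacian, Matrix.sub_apply, sub_smul, smul_sub, Finset.sum_sub_distrib,
    Matrix.diagonal_apply, ite_smul, zero_smul, Finset.sum_ite_eq, Finset.mem_univ, if_true,
    Finset.sum_smul]

end Network

/-- Tuning parameters of the estimators: dual gains `α_{λ,i}`, `α_{υ,i}`, and the constants `ε_i`. -/
structure Gains (N : ℕ) where
  alphaLam : Fin N → ℝ
  alphaUps : Fin N → ℝ
  eps : Fin N → ℝ

/-! ### Half-vectorization -/

/-- Positions on and above the diagonal; there are `n (n + 1) / 2` of them. -/
abbrev VechIdx (n : ℕ) : Type := {p : Fin n × Fin n // p.1 ≤ p.2}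

/-- Half-vectorization of a symmetric matrix (its upper triangular part). -/
def vech {n : ℕ} (M : Matrix (Fin n) (Fin n) ℝ) : VechIdx n → ℝ := fun p => M p.1.1 p.1.2

/-- The symmetric matrix with a given half-vectorization. -/
def unvech {n : ℕ} (t : VechIdx n → ℝ) : Matrix (Fin n) (Fin n) ℝ :=
  Matrix.of fun a b => if h : a ≤ b then t ⟨(a, b), h⟩ else t ⟨(b, a), (not_le.mp h).le⟩

theorem vech_unvech {n : ℕ} (t : VechIdx n → ℝ) : vech (unvech t) = t := by
  funext p
  have hp : p.1.1 ≤ p.1.2 := p.2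
  simp [vech, unvech, hp]

theorem unvech_vech {n : ℕ} (M : Matrix (Fin n) (Fin n) ℝ) (hM : M.IsSymm) :
    unvech (vech M) = M := by
  ext a b
  by_cases h : a ≤ b
  · simp [vech, unvech, h]
  · simpa [vech, unvech, h] using hM.apply a b

section Algorithm

variable {N n : ℕ} {m : Fin N → ℕ}

/-! ### Distributed information rate and covariance update -/

/-- `ω^δ_i = vech (H_iᵀ R_i⁻¹ H_i)`. -/
noncomputable def localInfo (S : LinSystem N n m) (i : Fin N) : VechIdx n → ℝ :=
  vech ((S.H i)ᵀ * (S.R i)⁻¹ * S.H i)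

/-- One subiteration of the information rate update on the pair `(υ, θ)`:
`υ⁺_i = υ_i + α_{υ,i} ∑_j a_ij (θ_i - θ_j)`, then `θ⁺_i = N ω^δ_i - ∑_j a_ij (υ⁺_i - υ⁺_j)`. -/
noncomputable def infoStep (S : LinSystem N n m) (G : Network N) (g : Gains N)
    (s : (Fin N → VechIdx n → ℝ) × (Fin N → VechIdx n → ℝ)) :
    (Fin N → VechIdx n → ℝ) × (Fin N → VechIdx n → ℝ) :=
  let ups : Fin N → VechIdx n → ℝ := fun i => s.1 i + g.alphaUps i • G.disagreement s.2 i
  (ups, fun i => (N : ℝ) • localInfo S i - G.disagreement ups i)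

/-- `(υ_{k,l*}, θ_{k,l*})`: the values reached at time `k` are the starting values at time `k + 1`. -/
noncomputable def infoState (S : LinSystem N n m) (G : Network N) (g : Gains N) (lstar : ℕ) :
    ℕ → (Fin N → VechIdx n → ℝ) × (Fin N → VechIdx n → ℝ)
  | 0 => (0, localInfo S)
  | k + 1 => (infoStep S G g)^[lstar] (infoState S G g lstar k)

/-- `Θ_{i,k,l*}`. -/
noncomputable def infoRate (S : LinSystem N n m) (G : Network N) (g : Gains N) (lstar k : ℕ)
    (i : Fin N) : Matrix (Fin n) (Fin n) ℝ :=
  unvech ((infoState S G g lstar k).2 i)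

/-- Covariance prediction `F P Fᵀ + Q`. -/
def predictCov (S : LinSystem N n m) (P : Matrix (Fin n) (Fin n) ℝ) : Matrix (Fin n) (Fin n) ℝ :=
  S.F * P * S.Fᵀ + S.Q

/-- The local covariances `P_{i,k}`, started at `Phat0`:
`P_{i,k+1} = (P_{i,k+1|k}⁻¹ + Θ_{i,k+1,l*})⁻¹`, where `P_{i,k+1|k} = F P_{i,k} Fᵀ + Q`. -/
noncomputable def localCov (S : LinSystem N n m) (G : Network N) (g : Gains N) (lstar : ℕ)
    (Phat0 : Fin N → Matrix (Fin n) (Fin n) ℝ) : ℕ → Fin N → Matrix (Fin n) (Fin n) ℝ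
  | 0 => Phat0
  | k + 1 => fun i =>
      ((predictCov S (localCov S G g lstar Phat0 k i))⁻¹ + infoRate S G g lstar (k + 1) i)⁻¹

/-! ### Distributed estimate update -/

/-- `K^cons_i = (H_iᵀ R_i⁻¹ H_i + (1/N) Pm⁻¹)⁻¹`, where `Pm` is the predicted covariance. -/
noncomputable def Kcons (S : LinSystem N n m) (i : Fin N) (Pm : Matrix (Fin n) (Fin n) ℝ) :
    Matrix (Fin n) (Fin n) ℝ :=
  ((S.H i)ᵀ * (S.R i)⁻¹ * S.H i + (1 / (N : ℝ)) • Pm⁻¹)⁻¹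

/-- `K^inno_i = K^cons_i H_iᵀ R_i⁻¹`. -/
noncomputable def Kinno (S : LinSystem N n m) (i : Fin N) (Pm : Matrix (Fin n) (Fin n) ℝ) :
    Matrix (Fin n) (Fin (m i)) ℝ :=
  Kcons S i Pm * (S.H i)ᵀ * (S.R i)⁻¹

/-- The scalar of `K^dual_i = (‖N Pm‖ + ε_i)⁻¹ I_n`, with the spectral norm. -/
noncomputable def Kdual (g : Gains N) (i : Fin N) (Pm : Matrix (Fin n) (Fin n) ℝ) : ℝ :=
  1 / (‖Matrix.toEuclideanCLM (n := Fin n) (𝕜 := ℝ) ((N : ℝ) • Pm)‖ + g.eps i)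

/-- One subiteration of the estimate update on the pair `(λ, ξ)`, given the predicted covariances `Pm`,
the predicted estimates `xm`, and the current measurements `y`:
`λ⁺_i = λ_i + α_{λ,i} K^dual_i ∑_j a_ij (ξ_i - ξ_j)`, then
`ξ⁺_i = xm_i + K^inno_i (y_i - H_i xm_i) - K^cons_i ∑_j a_ij (λ⁺_i - λ⁺_j)`. -/
noncomputable def estStep (S : LinSystem N n m) (G : Network N) (g : Gains N)
    (Pm : Fin N → Matrix (Fin n) (Fin n) ℝ) (xm : Fin N → Fin n → ℝ) (y : ∀ i, Fin (m i) → ℝ)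
    (s : (Fin N → Fin n → ℝ) × (Fin N → Fin n → ℝ)) :
    (Fin N → Fin n → ℝ) × (Fin N → Fin n → ℝ) :=
  let lam : Fin N → Fin n → ℝ := fun i =>
    s.1 i + (g.alphaLam i * Kdual g i (Pm i)) • G.disagreement s.2 i
  (lam, fun i => xm i + Kinno S i (Pm i) *ᵥ (y i - S.H i *ᵥ xm i)
    - Kcons S i (Pm i) *ᵥ G.disagreement lam i)

/-- The primal variable after `l` subiterations of `estStep` from `λ = 0`, `ξ = xm`. -/
noncomputable def correct (S : LinSystem N n m) (G : Network N) (g : Gains N)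
    (Pm : Fin N → Matrix (Fin n) (Fin n) ℝ) (xm : Fin N → Fin n → ℝ) (y : ∀ i, Fin (m i) → ℝ)
    (l : ℕ) : Fin N → Fin n → ℝ :=
  ((estStep S G g Pm xm y)^[l] (0, xm)).2

/-- The local estimates `xhat_{i,k}` computed from a measurement sequence `y`:
`xhat_{i,k+1} = ξ_{i,k+1,l*}`, where the subiterations at time `k + 1` start at `F xhat_{i,k}`. -/
noncomputable def localEst (S : LinSystem N n m) (G : Network N) (g : Gains N) (lstar : ℕ)
    (Phat0 : Fin N → Matrix (Fin n) (Fin n) ℝ) (xhat0 : Fin N → Fin n → ℝ)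
    (y : ℕ → ∀ i, Fin (m i) → ℝ) : ℕ → Fin N → Fin n → ℝ
  | 0 => xhat0
  | k + 1 => correct S G g (fun i => predictCov S (localCov S G g lstar Phat0 k i))
      (fun i => S.F *ᵥ localEst S G g lstar Phat0 xhat0 y k i) (y (k + 1)) lstar

/-- `ξ_{i,k,l}`, the estimate of estimator `i` at time `k ≥ 1` after `l` subiterations, when the number
of subiterations at the earlier times is `lstar`. -/
noncomputable def xi (S : LinSystem N n m) (G : Network N) (g : Gains N) (lstar : ℕ)
    (Phat0 : Fin N → Matrix (Fin n) (Fin n) ℝ) (xhat0 : Fin N → Fin n → ℝ)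
    (y : ℕ → ∀ i, Fin (m i) → ℝ) (i : Fin N) (k l : ℕ) : Fin n → ℝ :=
  correct S G g (fun i => predictCov S (localCov S G g lstar Phat0 (k - 1) i))
    (fun i => S.F *ᵥ localEst S G g lstar Phat0 xhat0 y (k - 1) i) (y k) l i

theorem localEst_succ (S : LinSystem N n m) (G : Network N) (g : Gains N) (lstar : ℕ)
    (Phat0 : Fin N → Matrix (Fin n) (Fin n) ℝ) (xhat0 : Fin N → Fin n → ℝ)
    (y : ℕ → ∀ i, Fin (m i) → ℝ) (i : Fin N) (k : ℕ) :
    localEst S G g lstar Phat0 xhat0 y (k + 1) i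
      = xi S G g lstar Phat0 xhat0 y i (k + 1) lstar := rfl

end Algorithm

/-! ### The stochastic model -/

section Model

variable {N n : ℕ} {m : Fin N → ℕ} {Ω : Type*} [MeasurableSpace Ω]

/-- The state process `x_{k+1} = F x_k + w_k`. -/
def state (S : LinSystem N n m) (x0 : Ω → Fin n → ℝ) (w : ℕ → Ω → Fin n → ℝ) :
    ℕ → Ω → Fin n → ℝ
  | 0 => x0
  | k + 1 => fun ω => S.F *ᵥ state S x0 w k ω + w k ω

/-- The measurements `y_{i,k} = H_i x_k + v_{i,k}`. -/
def measurement (S : LinSystem N n m) (x0 : Ω → Fin n → ℝ) (w : ℕ → Ω → Fin n → ℝ)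
    (v : ∀ i, ℕ → Ω → Fin (m i) → ℝ) (ω : Ω) (k : ℕ) (i : Fin N) : Fin (m i) → ℝ :=
  S.H i *ᵥ state S x0 w k ω + v i k ω

/-- All coordinates of all noise vectors, as one real-valued family. -/
def noiseFamily (w : ℕ → Ω → Fin n → ℝ) (v : ∀ i, ℕ → Ω → Fin (m i) → ℝ) :
    ℕ × (Fin n ⊕ (Σ i, Fin (m i))) → Ω → ℝ
  | (k, Sum.inl a) => fun ω => w k ω a
  | (k, Sum.inr p) => fun ω => v p.1 k ω p.2

/-- The standing assumptions on noises and initial state: `w_k`, `v_{i,k}` are zero-mean, jointly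
Gaussian, white and mutually uncorrelated with covariances `Q`, `R_i`; the initial state is Gaussian with
covariance `P0`, and is uncorrelated with the noises. -/
structure IsNoiseModel (S : LinSystem N n m) (μ : Measure Ω) (P0 : Matrix (Fin n) (Fin n) ℝ)
    (x0 : Ω → Fin n → ℝ) (w : ℕ → Ω → Fin n → ℝ) (v : ∀ i, ℕ → Ω → Fin (m i) → ℝ) : Prop where
  gaussian_noise : IsGaussianProcess (noiseFamily w v) μ
  mean_w : ∀ k a, ∫ ω, w k ω a ∂μ = 0
  mean_v : ∀ i k a, ∫ ω, v i k ω a ∂μ = 0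
  cov_w : ∀ k l a b, ∫ ω, w k ω a * w l ω b ∂μ = if k = l then S.Q a b else 0
  cov_v : ∀ i k l a b, ∫ ω, v i k ω a * v i l ω b ∂μ = if k = l then S.R i a b else 0
  cov_v_ne : ∀ i j, i ≠ j → ∀ k l a b, ∫ ω, v i k ω a * v j l ω b ∂μ = 0
  cov_w_v : ∀ i k l a b, ∫ ω, w k ω a * v i l ω b ∂μ = 0
  gaussian_x0 : HasGaussianLaw x0 μ
  cov_x0 : ∀ a b, covariance (fun ω => x0 ω a) (fun ω => x0 ω b) μ = P0 a b
  cov_x0_w : ∀ k a b, covariance (fun ω => x0 ω a) (fun ω => w k ω b) μ = 0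
  cov_x0_v : ∀ i k a b, covariance (fun ω => x0 ω a) (fun ω => v i k ω b) μ = 0

end Model

end DADKF

set_option linter.unusedSectionVars false

namespace DADKF

section MatrixOrderFacts

open scoped MatrixOrder

variable {ι κ : Type*} [Fintype ι] [DecidableEq ι] [Fintype κ]

theorem posSemidef_of_forall_dotProduct {A : Matrix ι ι ℝ} (hA : A.IsHermitian)
    (h : ∀ x : ι → ℝ, 0 ≤ x ⬝ᵥ A *ᵥ x) : A.PosSemidef :=
  Matrix.PosSemidef.of_dotProduct_mulVec_nonneg hA (by simpa using h)

theorem posDef_of_forall_dotProduct {A : Matrix ι ι ℝ} (hA : A.IsHermitian)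
    (h : ∀ x : ι → ℝ, x ≠ 0 → 0 < x ⬝ᵥ A *ᵥ x) : A.PosDef :=
  Matrix.PosDef.of_dotProduct_mulVec_pos hA (fun x hx => by simpa using h x hx)

theorem dotProduct_nonneg {A : Matrix ι ι ℝ} (hA : A.PosSemidef) (x : ι → ℝ) :
    0 ≤ x ⬝ᵥ A *ᵥ x := by simpa using hA.dotProduct_mulVec_nonneg x

theorem dotProduct_pos {A : Matrix ι ι ℝ} (hA : A.PosDef) {x : ι → ℝ} (hx : x ≠ 0) :
    0 < x ⬝ᵥ A *ᵥ x := by simpa using hA.dotProduct_mulVec_pos hx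

theorem isSymm_of_isHermitian {A : Matrix ι ι ℝ} (hA : A.IsHermitian) : Aᵀ = A := by
  rw [← Matrix.conjTranspose_eq_transpose_of_trivial]; exact hA

theorem dotProduct_le_of_le {A B : Matrix ι ι ℝ} (h : A ≤ B) (x : ι → ℝ) :
    x ⬝ᵥ A *ᵥ x ≤ x ⬝ᵥ B *ᵥ x := by
  have := dotProduct_nonneg (Matrix.le_iff.mp h) x
  rw [Matrix.sub_mulVec, dotProduct_sub] at this
  linarith

theorem le_of_forall_dotProduct {A B : Matrix ι ι ℝ} (hA : A.IsHermitian) (hB : B.IsHermitian)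
    (h : ∀ x : ι → ℝ, x ⬝ᵥ A *ᵥ x ≤ x ⬝ᵥ B *ᵥ x) : A ≤ B := by
  refine Matrix.le_iff.mpr (posSemidef_of_forall_dotProduct (hB.sub hA) fun x => ?_)
  rw [Matrix.sub_mulVec, dotProduct_sub]
  linarith [h x]

theorem posDef_of_le {A B : Matrix ι ι ℝ} (hA : A.PosDef) (h : A ≤ B) : B.PosDef := by
  have := hA.add_posSemidef (Matrix.le_iff.mp h)
  rwa [add_sub_cancel] at this

theorem dotProduct_mulVec_comm {A : Matrix ι ι ℝ} (hA : A.IsHermitian) (x y : ι → ℝ) :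
    x ⬝ᵥ A *ᵥ y = y ⬝ᵥ A *ᵥ x := by
  conv_lhs => rw [← isSymm_of_isHermitian hA]
  exact Matrix.dotProduct_transpose_mulVec A x y

theorem inv_mulVec_mulVec {A : Matrix ι ι ℝ} (hA : A.PosDef) (x : ι → ℝ) :
    A⁻¹ *ᵥ (A *ᵥ x) = x := by
  have := (Matrix.isUnit_iff_isUnit_det A).mp hA.isUnit
  rw [Matrix.mulVec_mulVec, Matrix.nonsing_inv_mul _ this, Matrix.one_mulVec]

theorem mulVec_inv_mulVec {A : Matrix ι ι ℝ} (hA : A.PosDef) (x : ι → ℝ) :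
    A *ᵥ (A⁻¹ *ᵥ x) = x := by
  have := (Matrix.isUnit_iff_isUnit_det A).mp hA.isUnit
  rw [Matrix.mulVec_mulVec, Matrix.mul_nonsing_inv _ this, Matrix.one_mulVec]

theorem posDef_inv_inv {A : Matrix ι ι ℝ} (hA : A.PosDef) : A⁻¹⁻¹ = A :=
  Matrix.nonsing_inv_nonsing_inv _ ((Matrix.isUnit_iff_isUnit_det A).mp hA.isUnit)

/-- The variational lower bound of the inverse quadratic form. -/
theorem two_mul_dotProduct_sub_le {A : Matrix ι ι ℝ} (hA : A.PosDef) (x u : ι → ℝ) :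
    2 * (x ⬝ᵥ u) - u ⬝ᵥ A *ᵥ u ≤ x ⬝ᵥ A⁻¹ *ᵥ x := by
  have h := dotProduct_nonneg hA.posSemidef (u - A⁻¹ *ᵥ x)
  have h2 : A⁻¹ *ᵥ x ⬝ᵥ A *ᵥ u = x ⬝ᵥ u := by
    rw [dotProduct_mulVec_comm hA.isHermitian, mulVec_inv_mulVec hA, dotProduct_comm]
  rw [Matrix.mulVec_sub, mulVec_inv_mulVec hA, dotProduct_sub, sub_dotProduct, sub_dotProduct,
    h2, dotProduct_comm u x, dotProduct_comm (A⁻¹ *ᵥ x) x] at h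
  linarith

theorem inv_le_inv_of_le {A B : Matrix ι ι ℝ} (hA : A.PosDef) (h : A ≤ B) : B⁻¹ ≤ A⁻¹ := by
  have hB := posDef_of_le hA h
  refine le_of_forall_dotProduct hB.inv.isHermitian hA.inv.isHermitian fun x => ?_
  have h1 := two_mul_dotProduct_sub_le hA x (B⁻¹ *ᵥ x)
  have h2 := dotProduct_le_of_le h (B⁻¹ *ᵥ x)
  rw [mulVec_inv_mulVec hB, dotProduct_comm (B⁻¹ *ᵥ x) x] at h2
  linarith

theorem conj_le_conj {A B : Matrix ι ι ℝ} (h : A ≤ B) (F : Matrix ι ι ℝ) :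
    F * A * Fᵀ ≤ F * B * Fᵀ := by
  have := (Matrix.le_iff.mp h).mul_mul_conjTranspose_same F
  rw [Matrix.conjTranspose_eq_transpose_of_trivial, Matrix.mul_sub, Matrix.sub_mul] at this
  exact Matrix.le_iff.mpr this

theorem conj_posSemidef {A : Matrix ι ι ℝ} (hA : A.PosSemidef) (F : Matrix κ ι ℝ) :
    (F * A * Fᵀ).PosSemidef := by
  have := hA.mul_mul_conjTranspose_same F
  rwa [Matrix.conjTranspose_eq_transpose_of_trivial] at this

theorem conj_posSemidef' {A : Matrix ι ι ℝ} (hA : A.PosSemidef) (F : Matrix ι κ ℝ) :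
    (Fᵀ * A * F).PosSemidef := by
  have := hA.conjTranspose_mul_mul_same F
  rwa [Matrix.conjTranspose_eq_transpose_of_trivial] at this

theorem norm_sq_toLp (x : ι → ℝ) : ‖WithLp.toLp 2 x‖ ^ 2 = x ⬝ᵥ x := by
  rw [EuclideanSpace.norm_sq_eq]
  simp [dotProduct, pow_two]

theorem dotProduct_mulVec_le_norm (A : Matrix ι ι ℝ) (x : ι → ℝ) :
    x ⬝ᵥ A *ᵥ x ≤ ‖Matrix.toEuclideanCLM (n := ι) (𝕜 := ℝ) A‖ * (x ⬝ᵥ x) := by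
  have h := Matrix.inner_toEuclideanCLM A (WithLp.toLp 2 x) (WithLp.toLp 2 x)
  have h2 := real_inner_le_norm (WithLp.toLp 2 x)
    (Matrix.toEuclideanCLM (n := ι) (𝕜 := ℝ) A (WithLp.toLp 2 x))
  have h3 := (Matrix.toEuclideanCLM (n := ι) (𝕜 := ℝ) A).le_opNorm (WithLp.toLp 2 x)
  rw [h] at h2
  rw [← norm_sq_toLp]
  have h4 := norm_nonneg (WithLp.toLp 2 x)
  calc _ ≤ _ := h2
    _ ≤ ‖WithLp.toLp 2 x‖ * (‖Matrix.toEuclideanCLM (n := ι) (𝕜 := ℝ) A‖ * ‖WithLp.toLp 2 x‖) := by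
      gcongr
    _ = _ := by ring

theorem le_norm_smul_one {A : Matrix ι ι ℝ} (hA : A.IsHermitian) :
    A ≤ ‖Matrix.toEuclideanCLM (n := ι) (𝕜 := ℝ) A‖ • (1 : Matrix ι ι ℝ) := by
  refine le_of_forall_dotProduct hA (by simp [Matrix.IsHermitian]) fun x => ?_
  simpa [Matrix.smul_mulVec] using dotProduct_mulVec_le_norm A x

theorem inv_smul_pos {A : Matrix ι ι ℝ} {t : ℝ} (ht : 0 < t) : (t • A)⁻¹ = t⁻¹ • A⁻¹ := by
  by_cases h : IsUnit A.det
  · refine Matrix.inv_eq_left_inv ?_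
    rw [Matrix.smul_mul, Matrix.mul_smul, smul_smul, Matrix.nonsing_inv_mul _ h,
      inv_mul_cancel₀ ht.ne', one_smul]
  · rw [Matrix.nonsing_inv_apply_not_isUnit _ h, Matrix.nonsing_inv_apply_not_isUnit, smul_zero]
    simpa [Matrix.det_smul, ht.ne'] using h

theorem exists_smul_one_le {B : Matrix ι ι ℝ} (hB : B.PosDef) :
    ∃ t : ℝ, 0 < t ∧ (1 : Matrix ι ι ℝ) ≤ t • B := by
  set c := ‖Matrix.toEuclideanCLM (n := ι) (𝕜 := ℝ) B⁻¹‖ + 1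
  have hc : 0 < c := by positivity
  refine ⟨c, hc, ?_⟩
  have h1 : B⁻¹ ≤ c • (1 : Matrix ι ι ℝ) := (le_norm_smul_one hB.inv.isHermitian).trans
    (smul_le_smul_of_nonneg_right (by simp [c]) Matrix.PosSemidef.one.nonneg)
  have h2 := inv_le_inv_of_le hB.inv h1
  rw [posDef_inv_inv hB, inv_smul_pos hc, inv_one] at h2
  have h3 := smul_le_smul_of_nonneg_left h2 hc.le
  rwa [smul_smul, mul_inv_cancel₀ hc.ne', one_smul] at h3

theorem exists_le_smul {A B : Matrix ι ι ℝ} (hA : A.IsHermitian) (hB : B.PosDef) :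
    ∃ t : ℝ, 1 ≤ t ∧ A ≤ t • B := by
  obtain ⟨t, ht, h⟩ := exists_smul_one_le hB
  set c := ‖Matrix.toEuclideanCLM (n := ι) (𝕜 := ℝ) A‖
  have hc : 0 ≤ c := norm_nonneg _
  refine ⟨max 1 (c * t), le_max_left _ _, (le_norm_smul_one hA).trans ?_⟩
  refine (smul_le_smul_of_nonneg_left h hc).trans ?_
  rw [smul_smul]
  exact smul_le_smul_of_nonneg_right (le_max_right _ _) hB.posSemidef.nonneg

/-- Completion of squares for the measurement update. -/
theorem dotProduct_inv_add_inv_le {X W : Matrix ι ι ℝ} (hX : X.PosDef) (hW : W.PosSemidef)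
    (y u : ι → ℝ) :
    y ⬝ᵥ (X⁻¹ + W)⁻¹ *ᵥ y ≤ (y - W *ᵥ u) ⬝ᵥ X *ᵥ (y - W *ᵥ u) + u ⬝ᵥ W *ᵥ u := by
  have hZ : (X⁻¹ + W).PosDef := hX.inv.add_posSemidef hW
  obtain ⟨v, rfl⟩ : ∃ v, y = (X⁻¹ + W) *ᵥ v := ⟨_, (mulVec_inv_mulVec hZ y).symm⟩
  obtain ⟨d, rfl⟩ : ∃ d, u = v - d := ⟨v - u, by simp⟩
  have h1 : (X⁻¹ + W) *ᵥ v - W *ᵥ (v - d) = X⁻¹ *ᵥ v + W *ᵥ d := by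
    rw [Matrix.add_mulVec, Matrix.mulVec_sub]; abel
  rw [inv_mulVec_mulVec hZ, h1, Matrix.mulVec_add, mulVec_inv_mulVec hX]
  have e1 : (X⁻¹ *ᵥ v) ⬝ᵥ X *ᵥ (W *ᵥ d) = v ⬝ᵥ W *ᵥ d := by
    rw [dotProduct_mulVec_comm hX.isHermitian, mulVec_inv_mulVec hX, dotProduct_comm]
  have e2 : d ⬝ᵥ W *ᵥ v = v ⬝ᵥ W *ᵥ d := dotProduct_mulVec_comm hW.isHermitian _ _
  have h3 := dotProduct_nonneg hW d
  have h4 := dotProduct_nonneg hX.posSemidef (W *ᵥ d)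
  simp only [Matrix.add_mulVec, Matrix.mulVec_sub, dotProduct_add, add_dotProduct,
    dotProduct_sub, sub_dotProduct]
  rw [e1, e2, dotProduct_comm (X⁻¹ *ᵥ v) v, dotProduct_comm (W *ᵥ d) v,
    dotProduct_comm (W *ᵥ v) v]
  linarith

end MatrixOrderFacts

section Riccati

open scoped MatrixOrder

variable {ι : Type*} [Fintype ι] [DecidableEq ι]

theorem tendsto_matrix_inv {α : Type*} {l : Filter α} {A : α → Matrix ι ι ℝ} {B : Matrix ι ι ℝ}
    (hB : B.PosDef) (h : Tendsto A l (𝓝 B)) : Tendsto (fun a => (A a)⁻¹) l (𝓝 B⁻¹) := by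
  simp only [Matrix.inv_def, Ring.inverse_eq_inv']
  have hdet : B.det ≠ 0 := ((Matrix.isUnit_iff_isUnit_det B).mp hB.isUnit).ne_zero
  have h1 : Tendsto (fun a => (A a).det) l (𝓝 B.det) :=
    (Continuous.tendsto (Continuous.matrix_det continuous_id) B).comp h
  have h2 : Tendsto (fun a => (A a).adjugate) l (𝓝 B.adjugate) :=
    (Continuous.tendsto (Continuous.matrix_adjugate continuous_id) B).comp h
  exact (h1.inv₀ hdet).smul h2

theorem tendsto_dotProduct_mulVec {α : Type*} {l : Filter α} {A : α → Matrix ι ι ℝ}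
    {B : Matrix ι ι ℝ} (h : Tendsto A l (𝓝 B)) (x : ι → ℝ) :
    Tendsto (fun a => x ⬝ᵥ A a *ᵥ x) l (𝓝 (x ⬝ᵥ B *ᵥ x)) := by
  have : Continuous fun M : Matrix ι ι ℝ => x ⬝ᵥ M *ᵥ x :=
    continuous_const.dotProduct (continuous_id.matrix_mulVec continuous_const)
  exact (this.tendsto B).comp h

/-- Polarization: the entries of a symmetric matrix from its quadratic form. -/
theorem entry_eq_polarization {A : Matrix ι ι ℝ} (hA : A.IsHermitian) (a b : ι) :
    A a b = 2⁻¹ * ((Pi.single a 1 + Pi.single b 1) ⬝ᵥ A *ᵥ (Pi.single a 1 + Pi.single b 1)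
      - Pi.single a 1 ⬝ᵥ A *ᵥ Pi.single a 1 - Pi.single b 1 ⬝ᵥ A *ᵥ Pi.single b 1) := by
  have h : A b a = A a b := by simpa using hA.apply a b
  simp [Matrix.mulVec_add, dotProduct_add, add_dotProduct, h]
  ring

theorem tendsto_of_tendsto_dotProduct {α : Type*} {l : Filter α} {A : α → Matrix ι ι ℝ}
    {B : Matrix ι ι ℝ} (hA : ∀ a, (A a).IsHermitian) (hB : B.IsHermitian)
    (h : ∀ x : ι → ℝ, Tendsto (fun a => x ⬝ᵥ A a *ᵥ x) l (𝓝 (x ⬝ᵥ B *ᵥ x))) :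
    Tendsto A l (𝓝 B) := by
  refine tendsto_pi_nhds.mpr fun a => tendsto_pi_nhds.mpr fun b => ?_
  simp_rw [fun k => entry_eq_polarization (hA k) a b, entry_eq_polarization hB a b]
  exact (((h _).sub (h _)).sub (h _)).const_mul _

theorem exists_tendsto_of_monotone {A : ℕ → Matrix ι ι ℝ} (hA : ∀ k, (A k).IsHermitian)
    (hmono : Monotone A) (hbdd : ∀ x : ι → ℝ, ∃ C, ∀ k, x ⬝ᵥ A k *ᵥ x ≤ C) :
    ∃ B : Matrix ι ι ℝ, Tendsto A atTop (𝓝 B) ∧ ∀ k, A k ≤ B := by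
  have hm : ∀ x : ι → ℝ, Monotone fun k => x ⬝ᵥ A k *ᵥ x := fun x i j hij =>
    dotProduct_le_of_le (hmono hij) x
  have hlim : ∀ x : ι → ℝ, ∃ q, Tendsto (fun k => x ⬝ᵥ A k *ᵥ x) atTop (𝓝 q) := fun x => by
    obtain ⟨C, hC⟩ := hbdd x
    exact ⟨_, tendsto_atTop_ciSup (hm x) ⟨C, by rintro _ ⟨k, rfl⟩; exact hC k⟩⟩
  choose q hq using hlim
  have hentry : ∀ a b, ∃ c, Tendsto (fun k => A k a b) atTop (𝓝 c) := fun a b => by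
    refine ⟨_, Tendsto.congr (fun k => (entry_eq_polarization (hA k) a b).symm)
      ((((hq _).sub (hq _)).sub (hq _)).const_mul _)⟩
  choose B hB using hentry
  have hAB : Tendsto A atTop (𝓝 (Matrix.of B)) :=
    tendsto_pi_nhds.mpr fun a => tendsto_pi_nhds.mpr fun b => hB a b
  have hBh : (Matrix.of B).IsHermitian := by
    ext a b
    exact tendsto_nhds_unique (hB b a) ((hB a b).congr fun k => by simpa using (hA k).apply b a)
  refine ⟨_, hAB, fun k => le_of_forall_dotProduct (hA k) hBh fun x => ?_⟩
  exact (hm x).ge_of_tendsto (tendsto_dotProduct_mulVec hAB x) k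

/-- The Riccati map on predicted covariances with information matrix `T`. -/
noncomputable def riccati (F Q T X : Matrix ι ι ℝ) : Matrix ι ι ℝ := F * (X⁻¹ + T)⁻¹ * Fᵀ + Q

variable {F Q T T' X Y : Matrix ι ι ℝ}

theorem posDef_inv_add_inv (hX : X.PosDef) (hT : T.PosSemidef) : ((X⁻¹ + T)⁻¹).PosDef :=
  (hX.inv.add_posSemidef hT).inv

theorem posDef_conj_add (hQ : Q.PosDef) (hX : X.PosSemidef) : (F * X * Fᵀ + Q).PosDef :=
  hQ.posSemidef_add (conj_posSemidef hX F)

theorem riccati_posDef (hQ : Q.PosDef) (hX : X.PosDef) (hT : T.PosSemidef) :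
    (riccati F Q T X).PosDef :=
  posDef_conj_add hQ (posDef_inv_add_inv hX hT).posSemidef

theorem le_riccati (hX : X.PosDef) (hT : T.PosSemidef) : Q ≤ riccati F Q T X := by
  have := (conj_posSemidef (posDef_inv_add_inv hX hT).posSemidef F).nonneg
  simpa [riccati] using this

theorem riccati_mono (hX : X.PosDef) (hT : T.PosSemidef) (h : X ≤ Y) :
    riccati F Q T X ≤ riccati F Q T Y := by
  have hY := posDef_of_le hX h
  have h1 : Y⁻¹ + T ≤ X⁻¹ + T := by gcongr; exact inv_le_inv_of_le hX h
  have h2 := inv_le_inv_of_le (hY.inv.add_posSemidef hT) h1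
  unfold riccati
  gcongr
  exact conj_le_conj h2 F

theorem dotProduct_riccati_le (hX : X.PosDef) (hT : T.PosSemidef) (x u : ι → ℝ) :
    x ⬝ᵥ riccati F Q T X *ᵥ x ≤
      (Fᵀ *ᵥ x - T *ᵥ u) ⬝ᵥ X *ᵥ (Fᵀ *ᵥ x - T *ᵥ u) + u ⬝ᵥ T *ᵥ u + x ⬝ᵥ Q *ᵥ x := by
  have h := dotProduct_inv_add_inv_le hX hT (Fᵀ *ᵥ x) u
  have e : x ⬝ᵥ (F * (X⁻¹ + T)⁻¹ * Fᵀ) *ᵥ x = Fᵀ *ᵥ x ⬝ᵥ (X⁻¹ + T)⁻¹ *ᵥ Fᵀ *ᵥ x := by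
    rw [← Matrix.mulVec_mulVec, ← Matrix.mulVec_mulVec, Matrix.dotProduct_mulVec x F,
      Matrix.mulVec_transpose]
  rw [riccati, Matrix.add_mulVec, dotProduct_add, e]
  linarith

/-- If `T F^i`, `i < d`, separate points, then the Riccati iterates have bounded quadratic forms. -/
theorem riccati_iterates_bounded (hT : T.PosSemidef) (d : ℕ)
    (hobs : ∀ x : ι → ℝ, (∀ i < d, T *ᵥ (F ^ i *ᵥ x) = 0) → x = 0)
    {A : ℕ → Matrix ι ι ℝ} (hA : ∀ k, (A k).PosDef) (hstep : ∀ k, A (k + 1) = riccati F Q T (A k))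
    (x : ι → ℝ) : ∃ C, ∀ k, x ⬝ᵥ A k *ᵥ x ≤ C := by
  have back : ∀ (x u : ι → ℝ), (∃ C, ∀ k, (Fᵀ *ᵥ x - T *ᵥ u) ⬝ᵥ A k *ᵥ (Fᵀ *ᵥ x - T *ᵥ u) ≤ C) →
      ∃ C, ∀ k, x ⬝ᵥ A k *ᵥ x ≤ C := by
    rintro x u ⟨C, hC⟩
    refine ⟨max (x ⬝ᵥ A 0 *ᵥ x) (C + u ⬝ᵥ T *ᵥ u + x ⬝ᵥ Q *ᵥ x), fun k => ?_⟩
    rcases k with _ | k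
    · exact le_max_left _ _
    · refine le_trans ?_ (le_max_right _ _)
      rw [hstep]
      have := dotProduct_riccati_le (F := F) (Q := Q) (hA k) hT x u
      linarith [hC k]
  have drive : ∀ (j : ℕ) (x : ι → ℝ) (u : ℕ → ι → ℝ),
      (Fᵀ ^ j) *ᵥ x = ∑ i ∈ Finset.range j, (Fᵀ ^ i) *ᵥ (T *ᵥ u i) →
      ∃ C, ∀ k, x ⬝ᵥ A k *ᵥ x ≤ C := by
    intro j
    induction j with
    | zero =>
      intro x u h
      simp only [pow_zero, Matrix.one_mulVec, Finset.range_zero, Finset.sum_empty] at h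
      exact ⟨0, fun k => by simp [h]⟩
    | succ j ih =>
      intro x u h
      refine back x (u j) (ih _ u ?_)
      rw [Finset.sum_range_succ, pow_succ, ← Matrix.mulVec_mulVec] at h
      rw [Matrix.mulVec_sub, h, add_sub_cancel_right]
  set W : Matrix ι ι ℝ := ∑ i ∈ Finset.range d, (F ^ i)ᵀ * (Tᵀ * T) * F ^ i
  have hquad : ∀ y : ι → ℝ, y ⬝ᵥ W *ᵥ y =
      ∑ i ∈ Finset.range d, (T *ᵥ (F ^ i *ᵥ y)) ⬝ᵥ (T *ᵥ (F ^ i *ᵥ y)) := fun y => by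
    simp only [W, Matrix.sum_mulVec, dotProduct_sum]
    refine Finset.sum_congr rfl fun i _ => ?_
    rw [← Matrix.mulVec_mulVec, ← Matrix.mulVec_mulVec, Matrix.dotProduct_transpose_mulVec,
      dotProduct_comm, ← Matrix.mulVec_mulVec, Matrix.dotProduct_transpose_mulVec, dotProduct_comm]
  have hWh : W.IsHermitian := by
    rw [Matrix.IsHermitian, Matrix.conjTranspose_eq_transpose_of_trivial]
    simp only [W, Matrix.transpose_sum, Matrix.transpose_mul, Matrix.transpose_transpose,
      Matrix.mul_assoc]
  have hW : W.PosDef := by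
    refine posDef_of_forall_dotProduct hWh fun y hy => ?_
    rw [hquad]
    refine lt_of_le_of_ne (Finset.sum_nonneg fun i _ => by
      simpa using dotProduct_star_self_nonneg (T *ᵥ (F ^ i *ᵥ y))) fun h0 => hy (hobs y fun i hi => ?_)
    have := (Finset.sum_eq_zero_iff_of_nonneg (fun i _ => by
      simpa using dotProduct_star_self_nonneg (T *ᵥ (F ^ i *ᵥ y)))).mp h0.symm i
        (Finset.mem_range.mpr hi)
    exact dotProduct_self_eq_zero.mp this
  refine drive d x (fun i => T *ᵥ (F ^ i *ᵥ (W⁻¹ *ᵥ ((Fᵀ ^ d) *ᵥ x)))) ?_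
  conv_lhs => rw [← mulVec_inv_mulVec hW ((Fᵀ ^ d) *ᵥ x)]
  simp only [W, Matrix.sum_mulVec]
  refine Finset.sum_congr rfl fun i _ => ?_
  rw [isSymm_of_isHermitian hT.isHermitian, Matrix.transpose_pow]
  simp only [Matrix.mulVec_mulVec, Matrix.mul_assoc]

/-- Existence of a positive definite solution of the algebraic Riccati equation. -/
theorem exists_riccati_fixedPoint (hQ : Q.PosDef) (hT : T.PosSemidef) (d : ℕ)
    (hobs : ∀ x : ι → ℝ, (∀ i < d, T *ᵥ (F ^ i *ᵥ x) = 0) → x = 0) :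
    ∃ X : Matrix ι ι ℝ, X.PosDef ∧ riccati F Q T X = X := by
  set A : ℕ → Matrix ι ι ℝ := fun k => (riccati F Q T)^[k] Q
  have hstep : ∀ k, A (k + 1) = riccati F Q T (A k) := fun k => Function.iterate_succ_apply' _ _ _
  have hA : ∀ k, (A k).PosDef := fun k => by
    induction k with
    | zero => exact hQ
    | succ k ih => rw [hstep]; exact riccati_posDef hQ ih hT
  have hmono : Monotone A := monotone_nat_of_le_succ fun k => by
    induction k with
    | zero => rw [hstep]; exact le_riccati (hA 0) hT
    | succ k ih => rw [hstep, hstep (k + 1)]; exact riccati_mono (hA k) hT ih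
  obtain ⟨X, hX, hle⟩ := exists_tendsto_of_monotone (fun k => (hA k).isHermitian) hmono
    (riccati_iterates_bounded hT d hobs hA hstep)
  have hXp : X.PosDef := posDef_of_le (hA 0) (hle 0)
  refine ⟨X, hXp, tendsto_nhds_unique ?_ ((tendsto_add_atTop_iff_nat 1).mpr hX)⟩
  simp_rw [hstep]
  have h1 := tendsto_matrix_inv (hXp.inv.add_posSemidef hT) ((tendsto_matrix_inv hXp hX).add_const T)
  exact ((tendsto_const_nhds.mul h1).mul tendsto_const_nhds).add_const Q

/-- The Riccati map contracts the order distance. -/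
theorem riccati_le_smul (hX : X.PosDef) (hY : Y.PosDef)
    (hT' : T'.PosSemidef) {t δ c : ℝ} (ht : 1 ≤ t) (hδ : 0 ≤ δ)
    (hXY : X ≤ t • Y) (hTT : T' ≤ (1 + δ) • T) (hc : c • riccati F Q T' Y ≤ Q) :
    riccati F Q T X ≤ (1 + (1 - c) * (t * (1 + δ) - 1)) • riccati F Q T' Y := by
  have ht0 : 0 < t := by linarith
  have hδ0 : 0 < 1 + δ := by linarith
  set s := t * (1 + δ) with hs
  have hs1 : 1 ≤ s := by nlinarith
  have hs0 : 0 < s := by linarith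
  have h1 : t⁻¹ • Y⁻¹ ≤ X⁻¹ := by
    rw [← inv_smul_pos ht0]; exact inv_le_inv_of_le hX hXY
  have h2 : (1 + δ)⁻¹ • T' ≤ T := by
    have := smul_le_smul_of_nonneg_left hTT (inv_nonneg.mpr hδ0.le)
    rwa [smul_smul, inv_mul_cancel₀ hδ0.ne', one_smul] at this
  have h3 : s⁻¹ • (Y⁻¹ + T') ≤ X⁻¹ + T := by
    rw [smul_add]
    refine add_le_add (le_trans ?_ h1) (le_trans ?_ h2)
    · refine smul_le_smul_of_nonneg_right ?_ hY.inv.posSemidef.nonneg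
      exact inv_anti₀ ht0 (by nlinarith)
    · refine smul_le_smul_of_nonneg_right ?_ hT'.nonneg
      exact inv_anti₀ hδ0 (by nlinarith)
  have hZ : (Y⁻¹ + T').PosDef := hY.inv.add_posSemidef hT'
  have h4 := inv_le_inv_of_le (hZ.smul (inv_pos.mpr hs0)) h3
  rw [inv_smul_pos (inv_pos.mpr hs0), inv_inv] at h4
  have h5 := conj_le_conj h4 F
  have h6 : riccati F Q T X ≤ s • riccati F Q T' Y - (s - 1) • Q := by
    have e : s • riccati F Q T' Y - (s - 1) • Q = F * s • (Y⁻¹ + T')⁻¹ * Fᵀ + Q := by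
      rw [riccati, smul_add, sub_smul, one_smul, Matrix.mul_smul, Matrix.smul_mul]; abel
    rw [e, riccati]
    gcongr
  refine h6.trans ?_
  have h7 := smul_le_smul_of_nonneg_left hc (sub_nonneg.mpr hs1)
  calc s • riccati F Q T' Y - (s - 1) • Q
      ≤ s • riccati F Q T' Y - (s - 1) • c • riccati F Q T' Y := by gcongr
    _ = (1 + (1 - c) * (s - 1)) • riccati F Q T' Y := by
      rw [smul_smul, ← sub_smul]; congr 1; ring

/-- Two Riccati recursions with asymptotically ordered informations are asymptotically ordered. -/
theorem riccati_eventually_le {A B U V : ℕ → Matrix ι ι ℝ}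
    (hA : ∀ k, (A k).PosDef) (hB : ∀ k, (B k).PosDef)
    (hV : ∀ k, (V k).PosSemidef)
    (hAs : ∀ k, A (k + 1) = riccati F Q (U k) (A k))
    (hBs : ∀ k, B (k + 1) = riccati F Q (V k) (B k))
    {c : ℝ} (hc0 : 0 < c) (hc1 : c < 1) (hc : ∀ᶠ k in atTop, c • B k ≤ Q)
    (hUV : ∀ δ : ℝ, 0 < δ → ∀ᶠ k in atTop, V k ≤ (1 + δ) • U k) {ε : ℝ} (hε : 0 < ε) :
    ∀ᶠ k in atTop, A k ≤ (1 + ε) • B k := by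
  obtain ⟨δ, hδ0, hδε, hδc⟩ : ∃ δ : ℝ, 0 < δ ∧ 2 * (δ / c) * 2 ≤ ε ∧
      (1 - c) * (1 + δ) ≤ 1 - c / 2 := by
    refine ⟨min (c / 2) (ε * c / 4), by positivity, ?_, ?_⟩
    · have : min (c / 2) (ε * c / 4) ≤ ε * c / 4 := min_le_right _ _
      rw [mul_div_assoc', div_mul_eq_mul_div, div_le_iff₀ hc0]; linarith
    · have : min (c / 2) (ε * c / 4) ≤ c / 2 := min_le_left _ _
      nlinarith
  obtain ⟨K, hK⟩ := eventually_atTop.mp (hc.and (hUV δ hδ0))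
  obtain ⟨t, ht1, ht⟩ := exists_le_smul (hA K).isHermitian (hB K)
  have key : ∀ j, A (K + j) ≤ (1 + ((1 - c / 2) ^ j * (t - 1) + 2 * (δ / c))) • B (K + j) := by
    intro j
    induction j with
    | zero =>
      refine ht.trans (smul_le_smul_of_nonneg_right ?_ (hB K).posSemidef.nonneg)
      have : 0 ≤ δ / c := by positivity
      linarith
    | succ j ih =>
      have hp : 0 ≤ (1 - c / 2) ^ j * (t - 1) :=
        mul_nonneg (pow_nonneg (by linarith) _) (by linarith)
      have hd : 0 ≤ δ / c := by positivity
      have hBn := (hBs (K + j)) ▸ (hK (K + j + 1) (by omega)).1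
      have h := riccati_le_smul (F := F) (Q := Q) (hA _) (hB _) (hV _) (by linarith) hδ0.le ih
        (hK (K + j) (by omega)).2 hBn
      rw [← hAs, ← hBs] at h
      refine h.trans (smul_le_smul_of_nonneg_right ?_ (hB _).posSemidef.nonneg)
      set s := (1 - c / 2) ^ j * (t - 1) + 2 * (δ / c) with hs
      have hdc : δ / c * c = δ := by field_simp
      have e : (1 - c / 2) ^ (j + 1) * (t - 1) = (1 - c / 2) * (s - 2 * (δ / c)) := by
        rw [hs, pow_succ]; ring
      rw [e]
      have hs0 : 0 ≤ s := by linarith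
      nlinarith [mul_nonneg hδ0.le hc0.le]
  have hlim : Tendsto (fun j : ℕ => (1 - c / 2) ^ j * (t - 1)) atTop (𝓝 0) := by
    simpa using (tendsto_pow_atTop_nhds_zero_of_lt_one (by linarith : 0 ≤ 1 - c / 2)
      (by linarith)).mul_const (t - 1)
  have hev := hlim.eventually (gt_mem_nhds (half_pos hε))
  obtain ⟨J, hJ⟩ := eventually_atTop.mp hev
  refine eventually_atTop.mpr ⟨K + J, fun k hk => ?_⟩
  obtain ⟨j, rfl⟩ : ∃ j, k = K + j := ⟨k - K, by omega⟩
  refine (key j).trans (smul_le_smul_of_nonneg_right ?_ (hB _).posSemidef.nonneg)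
  have := hJ j (by omega)
  linarith

theorem exists_smul_le_of_posDef (hQ : Q.PosDef) (hX : X.PosDef) :
    ∃ c : ℝ, 0 < c ∧ c ≤ 1 / 2 ∧ c • X ≤ Q := by
  obtain ⟨t, ht, h⟩ := exists_le_smul hX.isHermitian hQ
  have ht0 : 0 < t := by linarith
  refine ⟨(2 * t)⁻¹, by positivity, ?_, ?_⟩
  · rw [one_div]; exact inv_anti₀ (by norm_num) (by linarith)
  · calc (2 * t)⁻¹ • X ≤ (2 * t)⁻¹ • t • Q := smul_le_smul_of_nonneg_left h (by positivity)
      _ = (2⁻¹ : ℝ) • Q := by rw [smul_smul]; congr 1; field_simp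
      _ ≤ (1 : ℝ) • Q := smul_le_smul_of_nonneg_right (by norm_num) hQ.posSemidef.nonneg
      _ = Q := one_smul _ _

/-- Riccati recursions with asymptotically constant information converge to the fixed point. -/
theorem tendsto_riccati (hQ : Q.PosDef) (hT : T.PosSemidef) (hX : X.PosDef)
    (hfix : riccati F Q T X = X) {A U : ℕ → Matrix ι ι ℝ} (hA0 : (A 0).PosDef)
    (hU : ∀ k, (U k).PosSemidef) (hAs : ∀ k, A (k + 1) = riccati F Q (U k) (A k))
    (hUT : ∀ δ : ℝ, 0 < δ → ∀ᶠ k in atTop, U k ≤ (1 + δ) • T)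
    (hTU : ∀ δ : ℝ, 0 < δ → ∀ᶠ k in atTop, T ≤ (1 + δ) • U k) :
    Tendsto A atTop (𝓝 X) := by
  have hA : ∀ k, (A k).PosDef := fun k => by
    induction k with
    | zero => exact hA0
    | succ k ih => rw [hAs]; exact riccati_posDef hQ ih (hU k)
  obtain ⟨c, hc0, hc1, hc⟩ := exists_smul_le_of_posDef hQ hX
  have hup : ∀ ε : ℝ, 0 < ε → ∀ᶠ k in atTop, A k ≤ (1 + ε) • X := fun ε hε =>
    riccati_eventually_le (F := F) (B := fun _ => X) (V := fun _ => T) hA (fun _ => hX)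
      (fun _ => hT) hAs (fun _ => hfix.symm) hc0 (by linarith) (Eventually.of_forall fun _ => hc)
      hTU hε
  have hcA : ∀ᶠ k in atTop, (c / 2) • A k ≤ Q := by
    filter_upwards [hup 1 one_pos] with k hk
    calc (c / 2) • A k ≤ (c / 2) • (1 + 1 : ℝ) • X :=
          smul_le_smul_of_nonneg_left hk (by positivity)
      _ = c • X := by rw [smul_smul]; congr 1; ring
      _ ≤ Q := hc
  have hlow : ∀ ε : ℝ, 0 < ε → ∀ᶠ k in atTop, X ≤ (1 + ε) • A k := fun ε hε =>
    riccati_eventually_le (F := F) (A := fun _ => X) (U := fun _ => T) (fun _ => hX) hA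
      hU (fun _ => hfix.symm) hAs (half_pos hc0) (by linarith) hcA hUT hε
  refine tendsto_of_tendsto_dotProduct (fun k => (hA k).isHermitian) hX.isHermitian fun x => ?_
  have hx := dotProduct_nonneg hX.posSemidef x
  set q := x ⬝ᵥ X *ᵥ x
  rw [Metric.tendsto_nhds]
  intro ε hε
  set η := ε / (2 * (q + 1)) with hη
  have hη0 : 0 < η := by positivity
  have hηq : η * q < ε := by
    rw [hη, div_mul_eq_mul_div, div_lt_iff₀ (by positivity)]; nlinarith
  filter_upwards [hup η hη0, hlow η hη0] with k h1 h2
  have h1 := dotProduct_le_of_le h1 x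
  have h2 := dotProduct_le_of_le h2 x
  rw [Matrix.smul_mulVec, dotProduct_smul, smul_eq_mul] at h1 h2
  have hk := dotProduct_nonneg (hA k).posSemidef x
  rw [Real.dist_eq, abs_lt]
  constructor
  · by_contra! hcon
    have : x ⬝ᵥ A k *ᵥ x ≤ q := by linarith
    nlinarith
  · change x ⬝ᵥ A k *ᵥ x - q < ε
    linarith

/-- The error dynamics of the steady-state filter contracts the information norm. -/
theorem closedLoop_contraction (hT : T.PosSemidef) (hX : X.PosDef)
    (hfix : riccati F Q T X = X) {c : ℝ} (hc1 : c < 1) (hc : c • X ≤ Q) (e : ι → ℝ) :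
    (F *ᵥ ((X⁻¹ + T)⁻¹ *ᵥ (X⁻¹ *ᵥ e))) ⬝ᵥ X⁻¹ *ᵥ (F *ᵥ ((X⁻¹ + T)⁻¹ *ᵥ (X⁻¹ *ᵥ e)))
      ≤ (1 - c) * (e ⬝ᵥ X⁻¹ *ᵥ e) := by
  have hZi : (X⁻¹ + T).PosDef := hX.inv.add_posSemidef hT
  set Z := (X⁻¹ + T)⁻¹ with hZ
  have hZp : Z.PosDef := hZi.inv
  set w := Z *ᵥ (X⁻¹ *ᵥ e) with hw
  set v := X⁻¹ *ᵥ (F *ᵥ w) with hv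
  set s := (F *ᵥ w) ⬝ᵥ v
  have hle : F * Z * Fᵀ ≤ (1 - c) • X := by
    have : F * Z * Fᵀ = X - Q := by
      conv_rhs => rw [← hfix, riccati]
      simp [hZ]
    rw [this, sub_smul, one_smul]; gcongr
  have h1 := dotProduct_le_of_le hle v
  have hXv : X *ᵥ v = F *ᵥ w := mulVec_inv_mulVec hX _
  have e1 : v ⬝ᵥ (F * Z * Fᵀ) *ᵥ v = (Fᵀ *ᵥ v) ⬝ᵥ Z *ᵥ (Fᵀ *ᵥ v) := by
    rw [← Matrix.mulVec_mulVec, ← Matrix.mulVec_mulVec, Matrix.dotProduct_mulVec v F,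
      Matrix.mulVec_transpose]
  rw [e1, Matrix.smul_mulVec, dotProduct_smul, hXv, dotProduct_comm v, smul_eq_mul] at h1
  have h2 := two_mul_dotProduct_sub_le hZp.inv (Fᵀ *ᵥ v) ((1 - c) • w)
  rw [posDef_inv_inv hZp] at h2
  have e2 : (Fᵀ *ᵥ v) ⬝ᵥ w = s := by
    rw [dotProduct_comm, Matrix.dotProduct_transpose_mulVec, dotProduct_comm]
  have e3 : Z⁻¹ *ᵥ w = X⁻¹ *ᵥ e := inv_mulVec_mulVec hZp _
  rw [Matrix.mulVec_smul, dotProduct_smul, dotProduct_smul, smul_dotProduct, e2, e3] at h2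
  simp only [smul_eq_mul] at h2
  have hZX : Z ≤ X := by
    have : X⁻¹ ≤ X⁻¹ + T := by simpa using hT.nonneg
    have := inv_le_inv_of_le hX.inv this
    rwa [posDef_inv_inv hX] at this
  have h3 := dotProduct_le_of_le hZX (X⁻¹ *ᵥ e)
  rw [mulVec_inv_mulVec hX, ← hw, dotProduct_comm _ w, dotProduct_comm _ e] at h3
  have hc' : 0 < 1 - c := by linarith
  have h4 : s ≤ (1 - c) * (w ⬝ᵥ X⁻¹ *ᵥ e) := by
    have : (1 - c) * s ≤ (1 - c) * ((1 - c) * (w ⬝ᵥ X⁻¹ *ᵥ e)) := by linarith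
    exact le_of_mul_le_mul_left this hc'
  exact h4.trans (mul_le_mul_of_nonneg_left h3 hc'.le)

end Riccati

section Consensus

open scoped MatrixOrder

variable {ι : Type*} [Fintype ι] [DecidableEq ι]

theorem exists_tendsto_one_sub_pow {A : Matrix ι ι ℝ} (hA : A.PosSemidef)
    (h2 : ((2 : ℝ) • (1 : Matrix ι ι ℝ) - A).PosDef) :
    ∃ P : Matrix ι ι ℝ, Tendsto (fun l : ℕ => (1 - A) ^ l) atTop (𝓝 P) := by
  have hH := hA.isHermitian
  have hlt : ∀ i, hH.eigenvalues i < 2 := fun i => by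
    have hv : (hH.eigenvectorBasis i).ofLp ⬝ᵥ (hH.eigenvectorBasis i).ofLp = 1 := by
      have h1 : ‖hH.eigenvectorBasis i‖ = 1 := hH.eigenvectorBasis.orthonormal.1 i
      have h3 := norm_sq_toLp (hH.eigenvectorBasis i).ofLp
      rw [← h3]
      change ‖hH.eigenvectorBasis i‖ ^ 2 = 1
      rw [h1]; norm_num
    have hne : (hH.eigenvectorBasis i).ofLp ≠ 0 := fun h => by
      rw [h] at hv; simp at hv
    have h := dotProduct_pos h2 hne
    rw [Matrix.sub_mulVec, Matrix.smul_mulVec, Matrix.one_mulVec, dotProduct_sub, dotProduct_smul,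
      hv] at h
    have e := hH.eigenvalues_eq i
    simp only [star_trivial, RCLike.re_to_real] at e
    rw [e]
    simp at h
    linarith
  have hnn := hA.eigenvalues_nonneg
  have hlim : ∀ i, ∃ c, Tendsto (fun l : ℕ => (1 - hH.eigenvalues i) ^ l) atTop (𝓝 c) := fun i => by
    rcases (hnn i).eq_or_lt with h | h
    · refine ⟨1, ?_⟩
      have h' : hH.eigenvalues i = 0 := h.symm
      simp [h']
    · refine ⟨0, tendsto_pow_atTop_nhds_zero_of_abs_lt_one ?_⟩
      have h' : 0 < hH.eigenvalues i := h
      rw [abs_lt]; constructor <;> linarith [hlt i]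
  choose c hc using hlim
  set φ := Unitary.conjStarAlgAut ℝ (Matrix ι ι ℝ) hH.eigenvectorUnitary with hφ
  have hspec : A = φ (Matrix.diagonal hH.eigenvalues) := hH.spectral_theorem
  have hpow : ∀ l : ℕ, (1 - A) ^ l = φ (Matrix.diagonal fun i => (1 - hH.eigenvalues i) ^ l) := by
    intro l
    have e : (1 : Matrix ι ι ℝ) - A = φ (Matrix.diagonal fun i => 1 - hH.eigenvalues i) := by
      conv_lhs => rw [hspec]
      rw [← map_one φ, ← map_sub, ← Matrix.diagonal_one, Matrix.diagonal_sub]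
    rw [e, ← map_pow, Matrix.diagonal_pow]
    rfl
  have hcont : Continuous φ := by
    have : (φ : Matrix ι ι ℝ → Matrix ι ι ℝ) = fun X =>
        (hH.eigenvectorUnitary : Matrix ι ι ℝ) * X * star (hH.eigenvectorUnitary : Matrix ι ι ℝ) := by
      funext X; exact Unitary.conjStarAlgAut_apply _ _
    rw [this]
    exact (continuous_const.mul continuous_id).mul continuous_const
  refine ⟨φ (Matrix.diagonal c), ?_⟩
  simp_rw [hpow]
  refine (hcont.tendsto _).comp ?_
  exact ((continuous_id.matrix_diagonal).tendsto c).comp (tendsto_pi_nhds.mpr hc)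

/-- Convergence of a preconditioned gradient iteration. -/
theorem exists_tendsto_one_sub_mul_pow {K M : Matrix ι ι ℝ} (hK : K.PosDef) (hM : M.PosSemidef)
    (h2 : ((2 : ℝ) • K⁻¹ - M).PosDef) :
    ∃ P : Matrix ι ι ℝ, Tendsto (fun l : ℕ => (1 - K * M) ^ l) atTop (𝓝 P) ∧ M * P = 0 := by
  obtain ⟨B, hB⟩ := CStarAlgebra.nonneg_iff_eq_star_mul_self.mp hK.posSemidef.nonneg
  have hB' : K = Bᵀ * B := by
    rw [hB, Matrix.star_eq_conjTranspose, Matrix.conjTranspose_eq_transpose_of_trivial]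
  have hKdet : IsUnit K.det := (Matrix.isUnit_iff_isUnit_det K).mp hK.isUnit
  have hBdet : IsUnit B.det := by
    rw [hB', Matrix.det_mul, Matrix.det_transpose] at hKdet
    exact isUnit_of_mul_isUnit_left hKdet
  have hBtdet : IsUnit Bᵀ.det := by rwa [Matrix.det_transpose]
  have hA : (B * M * Bᵀ).PosSemidef := conj_posSemidef hM B
  have hdiff : ((2 : ℝ) • (1 : Matrix ι ι ℝ) - B * M * Bᵀ).PosDef := by
    have hinj : Function.Injective (B.vecMul) := by
      intro x y hxy
      have := congrArg (fun v => v ᵥ* B⁻¹) hxy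
      simpa [Matrix.vecMul_vecMul, Matrix.mul_nonsing_inv _ hBdet] using this
    have h := h2.mul_mul_conjTranspose_same hinj
    rw [Matrix.conjTranspose_eq_transpose_of_trivial, Matrix.mul_sub, Matrix.sub_mul,
      Matrix.mul_smul, Matrix.smul_mul] at h
    have e : B * K⁻¹ * Bᵀ = 1 := by
      rw [hB', Matrix.mul_inv_rev, ← Matrix.mul_assoc, Matrix.mul_nonsing_inv _ hBdet,
        Matrix.one_mul, Matrix.nonsing_inv_mul _ hBtdet]
    rwa [e] at h
  obtain ⟨P, hP⟩ := exists_tendsto_one_sub_pow hA hdiff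
  have hpow : ∀ l : ℕ, (1 - K * M) ^ l = Bᵀ * (1 - B * M * Bᵀ) ^ l * Bᵀ⁻¹ := by
    intro l
    induction l with
    | zero => simp [Matrix.mul_nonsing_inv _ hBtdet]
    | succ l ih =>
      rw [pow_succ, ih, pow_succ]
      have : Bᵀ⁻¹ * (1 - K * M) = (1 - B * M * Bᵀ) * Bᵀ⁻¹ := by
        rw [Matrix.mul_sub, Matrix.sub_mul, hB', Matrix.mul_one, Matrix.one_mul,
          Matrix.mul_assoc _ Bᵀ Bᵀ⁻¹, Matrix.mul_nonsing_inv _ hBtdet, Matrix.mul_one,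
          Matrix.mul_assoc Bᵀ, ← Matrix.mul_assoc Bᵀ⁻¹, Matrix.nonsing_inv_mul _ hBtdet,
          Matrix.one_mul]
      simp only [Matrix.mul_assoc, this]
  have hlim : Tendsto (fun l : ℕ => (1 - K * M) ^ l) atTop (𝓝 (Bᵀ * P * Bᵀ⁻¹)) := by
    simp_rw [hpow]
    exact (tendsto_const_nhds.mul hP).mul tendsto_const_nhds
  refine ⟨_, hlim, ?_⟩
  set R := Bᵀ * P * Bᵀ⁻¹
  have h1 : Tendsto (fun l : ℕ => (1 - K * M) ^ (l + 1)) atTop (𝓝 R) :=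
    (tendsto_add_atTop_iff_nat 1).mpr hlim
  have h3 : Tendsto (fun l : ℕ => (1 - K * M) ^ (l + 1)) atTop (𝓝 ((1 - K * M) * R)) := by
    simp_rw [pow_succ']
    exact tendsto_const_nhds.mul hlim
  have h4 := tendsto_nhds_unique h1 h3
  rw [Matrix.sub_mul, Matrix.one_mul, Matrix.mul_assoc] at h4
  have h5 : K * (M * R) = 0 := by simpa using h4.symm
  have h6 := congrArg (fun X => K⁻¹ * X) h5
  simpa [← Matrix.mul_assoc, Matrix.nonsing_inv_mul _ hKdet] using h6

theorem dotProduct_mul_diagonal_mul {L : Matrix ι ι ℝ} (hL : Lᵀ = L) (d x : ι → ℝ) :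
    x ⬝ᵥ (L * Matrix.diagonal d * L) *ᵥ x = ∑ i, d i * (L *ᵥ x) i ^ 2 := by
  rw [← Matrix.mulVec_mulVec, ← Matrix.mulVec_mulVec, Matrix.dotProduct_mulVec,
    ← Matrix.mulVec_transpose, hL]
  simp only [dotProduct, Matrix.mulVec_diagonal]
  exact Finset.sum_congr rfl fun i _ => by ring

/-- Dual ascent over a symmetric disagreement operator `L` with diagonal step sizes `d`. -/
theorem exists_tendsto_dualAscent {K L : Matrix ι ι ℝ} {d : ι → ℝ} {c σ : ℝ} (hK : K.PosDef)
    (hL : Lᵀ = L) (hσ : 0 < σ) (hLσ : ∀ x, (L *ᵥ x) ⬝ᵥ (L *ᵥ x) ≤ σ ^ 2 * (x ⬝ᵥ x)) (hc : 0 < c)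
    (hKc : K ≤ c • (1 : Matrix ι ι ℝ)) (hd : ∀ i, 0 < d i) (hdc : ∀ i, d i * c < 2 / σ ^ 2) :
    ∃ P : Matrix ι ι ℝ,
      Tendsto (fun l : ℕ => (1 - K * (L * Matrix.diagonal d * L)) ^ l) atTop (𝓝 P) ∧ L * P = 0 := by
  set M := L * Matrix.diagonal d * L with hMdef
  have hMh : M.IsHermitian := by
    rw [Matrix.IsHermitian, Matrix.conjTranspose_eq_transpose_of_trivial, hMdef]
    simp [Matrix.transpose_mul, hL, Matrix.mul_assoc]
  have hM : M.PosSemidef := posSemidef_of_forall_dotProduct hMh fun x => by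
    rw [dotProduct_mul_diagonal_mul hL]
    exact Finset.sum_nonneg fun i _ => mul_nonneg (hd i).le (sq_nonneg _)
  have hKinv : c⁻¹ • (1 : Matrix ι ι ℝ) ≤ K⁻¹ := by
    have := inv_le_inv_of_le hK hKc
    rwa [inv_smul_pos hc, inv_one] at this
  have h2 : ((2 : ℝ) • K⁻¹ - M).PosDef := by
    refine posDef_of_forall_dotProduct ((hK.inv.smul two_pos).isHermitian.sub hMh) fun x hx => ?_
    rw [Matrix.sub_mulVec, dotProduct_sub, Matrix.smul_mulVec, dotProduct_smul,
      dotProduct_mul_diagonal_mul hL, smul_eq_mul]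
    have hx1 := dotProduct_pos hK.inv hx
    have hx2 := dotProduct_le_of_le hKinv x
    rw [Matrix.smul_mulVec, dotProduct_smul, Matrix.one_mulVec, smul_eq_mul] at hx2
    by_cases h0 : L *ᵥ x = 0
    · simp only [h0, Pi.zero_apply]
      simpa using hx1
    · have hsum : ∑ i, d i * (L *ᵥ x) i ^ 2 < ∑ i, (2 / σ ^ 2 / c) * (L *ᵥ x) i ^ 2 := by
        obtain ⟨j, hj⟩ := Function.ne_iff.mp h0
        refine Finset.sum_lt_sum (fun i _ => ?_) ⟨j, Finset.mem_univ _, ?_⟩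
        · exact mul_le_mul_of_nonneg_right ((lt_div_iff₀ hc).mpr (hdc i)).le (sq_nonneg _)
        · exact mul_lt_mul_of_pos_right ((lt_div_iff₀ hc).mpr (hdc j)) (by
            have : (L *ᵥ x) j ≠ 0 := hj
            positivity)
      have e : ∑ i, (2 / σ ^ 2 / c) * (L *ᵥ x) i ^ 2 =
          (2 / σ ^ 2 / c) * ((L *ᵥ x) ⬝ᵥ (L *ᵥ x)) := by
        rw [← Finset.mul_sum, dotProduct]; congr 1
        exact Finset.sum_congr rfl fun i _ => by ring
      have h3 : (2 / σ ^ 2 / c) * ((L *ᵥ x) ⬝ᵥ (L *ᵥ x)) ≤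
          (2 / σ ^ 2 / c) * (σ ^ 2 * (x ⬝ᵥ x)) :=
        mul_le_mul_of_nonneg_left (hLσ x) (by positivity)
      have h4 : (2 / σ ^ 2 / c) * (σ ^ 2 * (x ⬝ᵥ x)) = 2 * (c⁻¹ * (x ⬝ᵥ x)) := by
        field_simp
      rw [e] at hsum
      linarith
  obtain ⟨P, hP, hMP⟩ := exists_tendsto_one_sub_mul_pow hK hM h2
  refine ⟨P, hP, ?_⟩
  have hcol : ∀ j, L *ᵥ P.col j = 0 := fun j => by
    have h0 : M *ᵥ P.col j = 0 := by
      funext i; exact congrFun (congrFun hMP i) j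
    have h1 := dotProduct_mul_diagonal_mul hL d (P.col j)
    rw [← hMdef, h0, dotProduct_zero] at h1
    funext i
    have := (Finset.sum_eq_zero_iff_of_nonneg
      (fun i _ => mul_nonneg (hd i).le (sq_nonneg _))).mp h1.symm i (Finset.mem_univ i)
    simpa [(hd i).ne'] using this
  ext i j
  exact congrFun (hcol j) i

end Consensus

namespace Network

variable {N : ℕ} (G : Network N)

theorem laplacian_transpose : G.laplacianᵀ = G.laplacian := by
  ext i j
  simp only [laplacian, Matrix.transpose_apply, Matrix.sub_apply, G.weight_symm j i,
    Matrix.diagonal_apply]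
  split_ifs with h1 h2 h2
  · rw [h1]
  · exact absurd h1.symm h2
  · exact absurd h2.symm h1
  · rfl

theorem laplacian_isHermitian : G.laplacian.IsHermitian := by
  rw [Matrix.IsHermitian, Matrix.conjTranspose_eq_transpose_of_trivial, laplacian_transpose]

theorem weight_nonneg (i j : Fin N) : 0 ≤ G.weight i j := by
  by_cases h : G.graph.Adj i j
  · exact (G.weight_pos i j h).le
  · exact (G.weight_zero i j h).ge

theorem laplacian_mulVec (x : Fin N → ℝ) : G.laplacian *ᵥ x = G.disagreement x := by
  funext i
  rw [disagreement_eq_laplacian]; rfl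

theorem dotProduct_laplacian (x : Fin N → ℝ) :
    x ⬝ᵥ G.laplacian *ᵥ x = 2⁻¹ * ∑ i, ∑ j, G.weight i j * (x i - x j) ^ 2 := by
  have h1 : x ⬝ᵥ G.laplacian *ᵥ x = ∑ i, ∑ j, G.weight i j * (x i * (x i - x j)) := by
    rw [laplacian_mulVec]
    simp only [dotProduct, disagreement, Finset.mul_sum, smul_eq_mul]
    exact Finset.sum_congr rfl fun i _ => Finset.sum_congr rfl fun j _ => by ring
  have h2 : x ⬝ᵥ G.laplacian *ᵥ x = ∑ i, ∑ j, G.weight i j * (x j * (x j - x i)) := by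
    rw [h1, Finset.sum_comm]
    exact Finset.sum_congr rfl fun i _ => Finset.sum_congr rfl fun j _ => by rw [G.weight_symm]
  have h3 : ∑ i, ∑ j, G.weight i j * (x i - x j) ^ 2 =
      x ⬝ᵥ G.laplacian *ᵥ x + x ⬝ᵥ G.laplacian *ᵥ x := by
    nth_rewrite 1 [h1]
    rw [h2, ← Finset.sum_add_distrib]
    refine Finset.sum_congr rfl fun i _ => ?_
    rw [← Finset.sum_add_distrib]
    exact Finset.sum_congr rfl fun j _ => by ring
  rw [h3]; ring

theorem laplacian_posSemidef : G.laplacian.PosSemidef :=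
  posSemidef_of_forall_dotProduct G.laplacian_isHermitian fun x => by
    rw [dotProduct_laplacian]
    exact mul_nonneg (by norm_num) (Finset.sum_nonneg fun i _ => Finset.sum_nonneg fun j _ =>
      mul_nonneg (G.weight_nonneg i j) (sq_nonneg _))

theorem eq_of_laplacian_mulVec_eq_zero (hG : G.graph.Connected) {x : Fin N → ℝ}
    (hx : G.laplacian *ᵥ x = 0) (i j : Fin N) : x i = x j := by
  have h := G.dotProduct_laplacian x
  rw [hx, dotProduct_zero] at h
  have hnn : ∀ i j, 0 ≤ G.weight i j * (x i - x j) ^ 2 := fun i j =>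
    mul_nonneg (G.weight_nonneg i j) (sq_nonneg _)
  have h0 : ∑ i, ∑ j, G.weight i j * (x i - x j) ^ 2 = 0 := by linarith
  have hadj : ∀ i j, G.graph.Adj i j → x i = x j := fun i j hij => by
    have h1 := (Finset.sum_eq_zero_iff_of_nonneg
      (fun i _ => Finset.sum_nonneg fun j _ => hnn i j)).mp h0 i (Finset.mem_univ i)
    have h2 := (Finset.sum_eq_zero_iff_of_nonneg (fun j _ => hnn i j)).mp h1 j (Finset.mem_univ j)
    have h3 := (mul_eq_zero.mp h2).resolve_left (G.weight_pos i j hij).ne'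
    exact sub_eq_zero.mp (pow_eq_zero_iff (two_ne_zero) |>.mp h3)
  obtain ⟨p⟩ := hG.preconnected i j
  induction p with
  | nil => rfl
  | cons hab _ ih => exact (hadj _ _ hab).trans ih

theorem laplacian_mulVec_one : G.laplacian *ᵥ (fun _ => 1) = 0 := by
  rw [laplacian_mulVec]; funext i; simp [disagreement]

theorem sum_disagreement {V : Type*} [AddCommGroup V] [Module ℝ V] (z : Fin N → V) :
    ∑ i, G.disagreement z i = 0 := by
  have h : ∑ i, G.disagreement z i = -∑ i, G.disagreement z i := by
    conv_lhs => simp only [disagreement]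
    rw [Finset.sum_comm, ← Finset.sum_neg_distrib]
    refine Finset.sum_congr rfl fun i _ => ?_
    rw [disagreement, ← Finset.sum_neg_distrib]
    refine Finset.sum_congr rfl fun j _ => ?_
    rw [G.weight_symm j i, ← smul_neg, neg_sub]
  have h2 : (2 : ℝ) • ∑ i, G.disagreement z i = 0 := by
    rw [two_smul]; nth_rewrite 1 [h]; exact neg_add_cancel _
  exact (smul_eq_zero.mp h2).resolve_left two_ne_zero

theorem laplacian_sq_le {σ : ℝ}
    (hσ : ∀ s : ℝ, Module.End.HasEigenvalue (Matrix.toLin' G.laplacian) s → s ≤ σ)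
    (x : Fin N → ℝ) :
    (G.laplacian *ᵥ x) ⬝ᵥ (G.laplacian *ᵥ x) ≤ σ ^ 2 * (x ⬝ᵥ x) := by
  have hH := G.laplacian_isHermitian
  have hnn := G.laplacian_posSemidef.eigenvalues_nonneg
  have hle : ∀ i, hH.eigenvalues i ≤ σ := fun i => by
    refine hσ _ (Module.End.hasEigenvalue_of_hasEigenvector (x := (hH.eigenvectorBasis i).ofLp) ?_)
    refine ⟨?_, ?_⟩
    · rw [Module.End.mem_eigenspace_iff, Matrix.toLin'_apply]
      exact hH.mulVec_eigenvectorBasis i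
    · intro h
      have h1 : ‖hH.eigenvectorBasis i‖ = 1 := hH.eigenvectorBasis.orthonormal.1 i
      have h2 : hH.eigenvectorBasis i = 0 := by
        ext a; exact congrFun h a
      rw [h2] at h1; simp at h1
  set b := hH.eigenvectorBasis
  have hrepr : ∀ y : Fin N → ℝ, y ⬝ᵥ y = ∑ i, (inner ℝ (b i) (WithLp.toLp 2 y)) ^ 2 := fun y => by
    rw [← norm_sq_toLp, ← b.sum_sq_norm_inner_right]
    simp
  rw [hrepr, hrepr, Finset.mul_sum]
  refine Finset.sum_le_sum fun i _ => ?_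
  have e : inner ℝ (b i) (WithLp.toLp 2 (G.laplacian *ᵥ x)) =
      hH.eigenvalues i * inner ℝ (b i) (WithLp.toLp 2 x) := by
    have h1 := Matrix.inner_toEuclideanCLM G.laplacian (b i) (WithLp.toLp 2 x)
    rw [Matrix.toEuclideanCLM_toLp] at h1
    rw [h1, dotProduct_mulVec_comm hH]
    change x ⬝ᵥ G.laplacian *ᵥ (hH.eigenvectorBasis i).ofLp = _
    rw [hH.mulVec_eigenvectorBasis i, dotProduct_smul, smul_eq_mul]
    congr 1
  rw [e, mul_pow]
  exact mul_le_mul_of_nonneg_right (pow_le_pow_left₀ (hnn i) (hle i) 2) (sq_nonneg _)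

end Network

section InfoRate

open scoped MatrixOrder

variable {N n : ℕ} {m : Fin N → ℕ}

/-- `H_iᵀ R_i⁻¹ H_i`. -/
noncomputable def sensorInfo (S : LinSystem N n m) (i : Fin N) : Matrix (Fin n) (Fin n) ℝ :=
  (S.H i)ᵀ * (S.R i)⁻¹ * S.H i

/-- `∑ i, H_iᵀ R_i⁻¹ H_i`. -/
noncomputable def totalInfo (S : LinSystem N n m) : Matrix (Fin n) (Fin n) ℝ :=
  ∑ i, sensorInfo S i

theorem sensorInfo_posSemidef {S : LinSystem N n m} (hR : ∀ i, (S.R i).PosDef) (i : Fin N) :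
    (sensorInfo S i).PosSemidef :=
  conj_posSemidef' (hR i).inv.posSemidef _

theorem totalInfo_posSemidef {S : LinSystem N n m} (hR : ∀ i, (S.R i).PosDef) :
    (totalInfo S).PosSemidef :=
  Matrix.posSemidef_sum _ fun i _ => sensorInfo_posSemidef hR i

/-- The coefficients of `(υ, θ)` with respect to the local informations. -/
noncomputable def infoCoeff (G : Network N) (g : Gains N) :
    ℕ → Matrix (Fin N) (Fin N) ℝ × Matrix (Fin N) (Fin N) ℝ
  | 0 => (0, 1)
  | T + 1 =>
    let U := (infoCoeff G g T).1 + Matrix.diagonal g.alphaUps * (G.laplacian * (infoCoeff G g T).2)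
    (U, (N : ℝ) • 1 - G.laplacian * U)

theorem disagreement_sum_smul {V : Type*} [AddCommGroup V] [Module ℝ V] (G : Network N)
    (C : Matrix (Fin N) (Fin N) ℝ) (v : Fin N → V) (i : Fin N) :
    G.disagreement (fun i => ∑ j, C i j • v j) i = ∑ j, (G.laplacian * C) i j • v j := by
  rw [Network.disagreement_eq_laplacian]
  simp only [Finset.smul_sum, smul_smul, Matrix.mul_apply, Finset.sum_smul]
  exact Finset.sum_comm

theorem infoStep_iterate (S : LinSystem N n m) (G : Network N) (g : Gains N) (T : ℕ) :
    (infoStep S G g)^[T] (0, localInfo S) =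
      (fun i => ∑ j, (infoCoeff G g T).1 i j • localInfo S j,
       fun i => ∑ j, (infoCoeff G g T).2 i j • localInfo S j) := by
  induction T with
  | zero =>
    refine Prod.ext (funext fun i => ?_) (funext fun i => ?_)
    · simp [infoCoeff]
    · simp [infoCoeff, Matrix.one_apply]
  | succ T ih =>
    rw [Function.iterate_succ_apply', ih]
    have h1 : (infoStep S G g (fun i => ∑ j, (infoCoeff G g T).1 i j • localInfo S j,
        fun i => ∑ j, (infoCoeff G g T).2 i j • localInfo S j)).1 =
        fun i => ∑ j, (infoCoeff G g (T + 1)).1 i j • localInfo S j := by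
      funext i
      simp only [infoStep, infoCoeff, disagreement_sum_smul, Matrix.add_apply, add_smul,
        Finset.sum_add_distrib, Finset.smul_sum, smul_smul, Matrix.diagonal_mul]
    refine Prod.ext h1 (funext fun i => ?_)
    have h2 : (infoStep S G g (fun i => ∑ j, (infoCoeff G g T).1 i j • localInfo S j,
        fun i => ∑ j, (infoCoeff G g T).2 i j • localInfo S j)).2 i =
        (N : ℝ) • localInfo S i - G.disagreement (infoStep S G g
          (fun i => ∑ j, (infoCoeff G g T).1 i j • localInfo S j,
           fun i => ∑ j, (infoCoeff G g T).2 i j • localInfo S j)).1 i := rfl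
    rw [h2, h1, disagreement_sum_smul]
    have h3 : (infoCoeff G g (T + 1)).2 =
      (N : ℝ) • 1 - G.laplacian * (infoCoeff G g (T + 1)).1 := rfl
    rw [h3]
    simp [Matrix.sub_apply, sub_smul, Finset.sum_sub_distrib, Matrix.one_apply]

theorem infoState_eq_iterate (S : LinSystem N n m) (G : Network N) (g : Gains N) (lstar k : ℕ) :
    infoState S G g lstar k = (infoStep S G g)^[lstar * k] (0, localInfo S) := by
  induction k with
  | zero => rfl
  | succ k ih =>
    rw [infoState, ih, ← Function.iterate_add_apply]
    congr 1; ring_nf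

theorem unvech_sum_smul (c : Fin N → ℝ) (t : Fin N → VechIdx n → ℝ) :
    unvech (∑ j, c j • t j) = ∑ j, c j • unvech (t j) := by
  ext a b
  rw [Matrix.sum_apply]
  by_cases h : a ≤ b <;> simp [unvech, h]

theorem infoRate_eq {S : LinSystem N n m} (hR : ∀ i, (S.R i).PosDef) (G : Network N) (g : Gains N)
    (lstar k : ℕ) (i : Fin N) :
    infoRate S G g lstar k i = ∑ j, (infoCoeff G g (lstar * k)).2 i j • sensorInfo S j := by
  rw [infoRate, infoState_eq_iterate, infoStep_iterate]
  simp only [unvech_sum_smul]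
  refine Finset.sum_congr rfl fun j _ => ?_
  congr 1
  exact unvech_vech _ (isSymm_of_isHermitian (sensorInfo_posSemidef hR j).isHermitian)

theorem infoCoeff_succ_eq (G : Network N) (g : Gains N) (T : ℕ) :
    (infoCoeff G g (T + 1)).2 =
      (1 - 1 * (G.laplacian * Matrix.diagonal g.alphaUps * G.laplacian)) ^ T *
        (infoCoeff G g 1).2 := by
  induction T with
  | zero => simp
  | succ T ih =>
    have h1 : (infoCoeff G g (T + 2)).2 = (infoCoeff G g (T + 1)).2 -
        G.laplacian * (Matrix.diagonal g.alphaUps * (G.laplacian * (infoCoeff G g (T + 1)).2)) := by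
      change (N : ℝ) • 1 - G.laplacian * ((infoCoeff G g (T + 1)).1 +
        Matrix.diagonal g.alphaUps * (G.laplacian * (infoCoeff G g (T + 1)).2)) =
        ((N : ℝ) • 1 - G.laplacian * (infoCoeff G g (T + 1)).1) - _
      rw [Matrix.mul_add]; abel
    rw [h1, pow_succ', Matrix.mul_assoc, ← ih, Matrix.sub_mul, Matrix.one_mul, Matrix.one_mul]
    simp only [Matrix.mul_assoc]

theorem vecMul_laplacian_one (G : Network N) : (fun _ => (1 : ℝ)) ᵥ* G.laplacian = 0 := by
  rw [← Matrix.mulVec_transpose, G.laplacian_transpose, G.laplacian_mulVec_one]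

theorem infoCoeff_col_sum (G : Network N) (g : Gains N) (T : ℕ) (j : Fin N) :
    ∑ i, (infoCoeff G g (T + 1)).2 i j = N := by
  have h : (fun _ => (1 : ℝ)) ᵥ* (infoCoeff G g (T + 1)).2 = fun _ => (N : ℝ) := by
    change (fun _ => (1 : ℝ)) ᵥ* ((N : ℝ) • 1 - G.laplacian * _) = _
    rw [Matrix.vecMul_sub, ← Matrix.vecMul_vecMul, vecMul_laplacian_one]
    funext j
    simp [Matrix.vecMul_smul]
  simpa [Matrix.vecMul, dotProduct] using congrFun h j

theorem tendsto_infoCoeff {G : Network N} (hconn : G.graph.Connected) {σ : ℝ} (hσ0 : 0 < σ)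
    (hσ : ∀ s : ℝ, Module.End.HasEigenvalue (Matrix.toLin' G.laplacian) s → s ≤ σ)
    {g : Gains N} (hups : ∀ i, 0 < g.alphaUps i ∧ g.alphaUps i < 2 / σ ^ 2) (i j : Fin N) :
    Tendsto (fun T => (infoCoeff G g T).2 i j) atTop (𝓝 1) := by
  obtain ⟨P, hP, hLP⟩ := exists_tendsto_dualAscent (K := 1) (c := 1) (d := g.alphaUps)
    Matrix.PosDef.one G.laplacian_transpose hσ0 (G.laplacian_sq_le hσ) one_pos
    (by simp) (fun i => (hups i).1) (fun i => by simpa using (hups i).2)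
  set C := P * (infoCoeff G g 1).2
  have hC : Tendsto (fun T => (infoCoeff G g (T + 1)).2) atTop (𝓝 C) :=
    (hP.mul tendsto_const_nhds).congr fun T => (infoCoeff_succ_eq G g T).symm
  have hent : ∀ i j, Tendsto (fun T => (infoCoeff G g (T + 1)).2 i j) atTop (𝓝 (C i j)) :=
    fun i j => tendsto_pi_nhds.mp (tendsto_pi_nhds.mp hC i) j
  have hLC : G.laplacian * C = 0 := by rw [← Matrix.mul_assoc, hLP, Matrix.zero_mul]
  have hconst : ∀ i i', C i j = C i' j := by
    have h0 : G.laplacian *ᵥ C.col j = 0 := by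
      funext i; exact congrFun (congrFun hLC i) j
    exact fun i i' => G.eq_of_laplacian_mulVec_eq_zero hconn h0 i i'
  have hsum : ∑ i, C i j = N := by
    refine tendsto_nhds_unique (tendsto_finsetSum _ fun i _ => hent i j) ?_
    simp_rw [infoCoeff_col_sum]
    exact tendsto_const_nhds
  have hN : (N : ℝ) ≠ 0 := by
    have : 0 < N := i.pos
    positivity
  have h1 : C i j = 1 := by
    rw [Finset.sum_congr rfl fun i' _ => hconst i' i] at hsum
    simpa [hN] using hsum
  rw [← h1]
  exact (tendsto_add_atTop_iff_nat 1).mp (hent i j)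

theorem sum_smul_le_smul_sum {a b : Fin N → ℝ} {t : ℝ} {W : Fin N → Matrix (Fin n) (Fin n) ℝ}
    (hW : ∀ j, (W j).PosSemidef) (h : ∀ j, a j ≤ t * b j) :
    ∑ j, a j • W j ≤ t • ∑ j, b j • W j := by
  rw [Finset.smul_sum]
  refine Finset.sum_le_sum fun j _ => ?_
  rw [smul_smul]
  exact smul_le_smul_of_nonneg_right (h j) (hW j).nonneg

/-- For enough subiterations the information rates are positive semidefinite, and they converge to
the total information in the order sense. -/
theorem exists_infoRate_bounds {S : LinSystem N n m} (hR : ∀ i, (S.R i).PosDef)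
    {G : Network N} (hconn : G.graph.Connected) {σ : ℝ} (hσ0 : 0 < σ)
    (hσ : ∀ s : ℝ, Module.End.HasEigenvalue (Matrix.toLin' G.laplacian) s → s ≤ σ)
    {g : Gains N} (hups : ∀ i, 0 < g.alphaUps i ∧ g.alphaUps i < 2 / σ ^ 2) :
    ∃ lbar : ℕ, ∀ lstar, lbar ≤ lstar → ∀ i,
      (∀ k, (infoRate S G g lstar (k + 1) i).PosSemidef) ∧
      (∀ δ : ℝ, 0 < δ → ∀ᶠ k in atTop,
        infoRate S G g lstar (k + 1) i ≤ (1 + δ) • totalInfo S) ∧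
      (∀ δ : ℝ, 0 < δ → ∀ᶠ k in atTop,
        totalInfo S ≤ (1 + δ) • infoRate S G g lstar (k + 1) i) := by
  have hlim := tendsto_infoCoeff hconn hσ0 hσ hups
  have hpos : ∀ᶠ T in atTop, ∀ i j, 0 < (infoCoeff G g T).2 i j :=
    eventually_all.mpr fun i => eventually_all.mpr fun j =>
      (hlim i j).eventually (lt_mem_nhds one_pos)
  obtain ⟨T0, hT0⟩ := eventually_atTop.mp hpos
  refine ⟨max 1 T0, fun lstar hl i => ?_⟩
  have hl1 : 1 ≤ lstar := le_trans (le_max_left _ _) hl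
  have hl2 : T0 ≤ lstar := le_trans (le_max_right _ _) hl
  have hs : Tendsto (fun k => lstar * (k + 1)) atTop atTop :=
    tendsto_atTop_mono (fun k => by simp only [id]; nlinarith) tendsto_id
  have htot : totalInfo S = ∑ j, (1 : ℝ) • sensorInfo S j := by simp [totalInfo]
  refine ⟨fun k => ?_, fun δ hδ => ?_, fun δ hδ => ?_⟩
  · rw [infoRate_eq hR]
    refine Matrix.posSemidef_sum _ fun j _ => (sensorInfo_posSemidef hR j).smul ?_
    exact (hT0 _ (by nlinarith) i j).le
  · have h : ∀ᶠ k in atTop, ∀ j, (infoCoeff G g (lstar * (k + 1))).2 i j < 1 + δ :=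
      eventually_all.mpr fun j => ((hlim i j).comp hs).eventually (gt_mem_nhds (by linarith))
    filter_upwards [h] with k hk
    rw [infoRate_eq hR, htot]
    exact sum_smul_le_smul_sum (sensorInfo_posSemidef hR) fun j => by linarith [hk j]
  · have h : ∀ᶠ k in atTop, ∀ j, 1 < (1 + δ) * (infoCoeff G g (lstar * (k + 1))).2 i j :=
      eventually_all.mpr fun j => (((hlim i j).comp hs).const_mul (1 + δ)).eventually
        (lt_mem_nhds (by linarith))
    filter_upwards [h] with k hk
    rw [infoRate_eq hR, htot]
    exact sum_smul_le_smul_sum (sensorInfo_posSemidef hR) fun j => (hk j).le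

/-- Observability in terms of the total information matrix. -/
theorem eq_zero_of_totalInfo {S : LinSystem N n m} (hR : ∀ i, (S.R i).PosDef)
    (hobs : S.Observable) (x : Fin n → ℝ)
    (h : ∀ i < n, totalInfo S *ᵥ (S.F ^ i *ᵥ x) = 0) : x = 0 := by
  have hH : ∀ y : Fin n → ℝ, totalInfo S *ᵥ y = 0 → ∀ i, S.H i *ᵥ y = 0 := by
    intro y hy i
    have e : ∀ i, y ⬝ᵥ sensorInfo S i *ᵥ y = (S.H i *ᵥ y) ⬝ᵥ (S.R i)⁻¹ *ᵥ (S.H i *ᵥ y) := fun i => by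
      rw [sensorInfo, ← Matrix.mulVec_mulVec, ← Matrix.mulVec_mulVec,
        Matrix.dotProduct_transpose_mulVec, dotProduct_comm]
    have h0 : y ⬝ᵥ totalInfo S *ᵥ y = 0 := by rw [hy, dotProduct_zero]
    rw [totalInfo, Matrix.sum_mulVec, dotProduct_sum] at h0
    have h1 := (Finset.sum_eq_zero_iff_of_nonneg fun i _ =>
      dotProduct_nonneg (sensorInfo_posSemidef hR i) y).mp h0 i (Finset.mem_univ i)
    by_contra hne
    have := dotProduct_pos (hR i).inv hne
    rw [e] at h1
    linarith
  have hker : S.obsMatrix *ᵥ x = 0 := by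
    funext p
    have h1 := congrFun (hH _ (h p.1 p.1.2) p.2.1) p.2.2
    rw [Matrix.mulVec_mulVec] at h1
    exact h1
  have hinj : Function.Injective S.obsMatrix.mulVec := by
    have h1 := S.obsMatrix.mulVecLin.finrank_range_add_finrank_ker
    have h2 : Module.finrank ℝ (LinearMap.range S.obsMatrix.mulVecLin) = n := hobs
    rw [h2, Module.finrank_fin_fun, Nat.add_eq_left] at h1
    exact LinearMap.ker_eq_bot.mp (Submodule.finrank_eq_zero.mp h1)
  exact hinj (by rw [hker, Matrix.mulVec_zero])

end InfoRate

section Estimates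

open scoped MatrixOrder

variable {N n : ℕ} {m : Fin N → ℕ}

theorem disagreement_add {V : Type*} [AddCommGroup V] [Module ℝ V] (G : Network N)
    (z z' : Fin N → V) (i : Fin N) :
    G.disagreement (z + z') i = G.disagreement z i + G.disagreement z' i := by
  simp only [Network.disagreement_eq_laplacian, Pi.add_apply, smul_add, Finset.sum_add_distrib]

theorem disagreement_smul {V : Type*} [AddCommGroup V] [Module ℝ V] (G : Network N) (c : ℝ)
    (z : Fin N → V) (i : Fin N) : G.disagreement (c • z) i = c • G.disagreement z i := by
  simp only [Network.disagreement_eq_laplacian, Pi.smul_apply, Finset.smul_sum]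
  exact Finset.sum_congr rfl fun j _ => smul_comm _ _ _

theorem disagreement_const {V : Type*} [AddCommGroup V] [Module ℝ V] (G : Network N) (v : V)
    (i : Fin N) : G.disagreement (fun _ => v) i = 0 := by
  simp [Network.disagreement]

variable (S : LinSystem N n m) (G : Network N) (g : Gains N) (Pm : Fin N → Matrix (Fin n) (Fin n) ℝ)

theorem estStep_add (xm xm' : Fin N → Fin n → ℝ) (y y' : ∀ i, Fin (m i) → ℝ)
    (s s' : (Fin N → Fin n → ℝ) × (Fin N → Fin n → ℝ)) :
    estStep S G g Pm (xm + xm') (y + y') (s + s') =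
      estStep S G g Pm xm y s + estStep S G g Pm xm' y' s' := by
  have h1 : (estStep S G g Pm (xm + xm') (y + y') (s + s')).1 =
      (estStep S G g Pm xm y s).1 + (estStep S G g Pm xm' y' s').1 := by
    funext i
    simp only [estStep, Pi.add_apply, Prod.fst_add, Prod.snd_add, disagreement_add, smul_add]
    abel
  refine Prod.ext h1 (funext fun i => ?_)
  have e : ∀ xm y s, (estStep S G g Pm xm y s).2 i = xm i + Kinno S i (Pm i) *ᵥ
    (y i - S.H i *ᵥ xm i) - Kcons S i (Pm i) *ᵥ
      G.disagreement (estStep S G g Pm xm y s).1 i := fun _ _ _ => rfl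
  rw [Prod.snd_add, Pi.add_apply, e, e, e, h1, disagreement_add]
  simp only [Pi.add_apply, Matrix.mulVec_add, Matrix.mulVec_sub]
  abel

theorem estStep_smul (c : ℝ) (xm : Fin N → Fin n → ℝ) (y : ∀ i, Fin (m i) → ℝ)
    (s : (Fin N → Fin n → ℝ) × (Fin N → Fin n → ℝ)) :
    estStep S G g Pm (c • xm) (c • y) (c • s) = c • estStep S G g Pm xm y s := by
  have h1 : (estStep S G g Pm (c • xm) (c • y) (c • s)).1 = c • (estStep S G g Pm xm y s).1 := by
    funext i
    simp only [estStep, Pi.smul_apply, Prod.smul_fst, Prod.smul_snd, disagreement_smul, smul_add,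
      smul_comm c]
  refine Prod.ext h1 (funext fun i => ?_)
  have e : ∀ xm y s, (estStep S G g Pm xm y s).2 i = xm i + Kinno S i (Pm i) *ᵥ
    (y i - S.H i *ᵥ xm i) - Kcons S i (Pm i) *ᵥ
      G.disagreement (estStep S G g Pm xm y s).1 i := fun _ _ _ => rfl
  rw [Prod.smul_snd, Pi.smul_apply, e, e, h1, disagreement_smul]
  simp only [Pi.smul_apply, Matrix.mulVec_smul, Matrix.mulVec_sub, smul_add, smul_sub]

/-- The corrected estimates depend linearly on predictions and measurements. -/
noncomputable def correctLinear (l : ℕ) :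
    ((Fin N → Fin n → ℝ) × (∀ i, Fin (m i) → ℝ)) →ₗ[ℝ] (Fin N → Fin n → ℝ) where
  toFun p := correct S G g Pm p.1 p.2 l
  map_add' p p' := by
    have h : ∀ l, (estStep S G g Pm (p.1 + p'.1) (p.2 + p'.2))^[l] (0, p.1 + p'.1) =
        (estStep S G g Pm p.1 p.2)^[l] (0, p.1) + (estStep S G g Pm p'.1 p'.2)^[l] (0, p'.1) := by
      intro l
      induction l with
      | zero => simp
      | succ l ih => simp only [Function.iterate_succ_apply', ih, estStep_add]
    exact congrArg Prod.snd (h l)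
  map_smul' c p := by
    have h : ∀ l, (estStep S G g Pm (c • p.1) (c • p.2))^[l] (0, c • p.1) =
        c • (estStep S G g Pm p.1 p.2)^[l] (0, p.1) := by
      intro l
      induction l with
      | zero => simp
      | succ l ih => simp only [Function.iterate_succ_apply', ih, estStep_smul]
    exact congrArg Prod.snd (h l)

theorem correctLinear_apply (l : ℕ) (xm : Fin N → Fin n → ℝ) (y : ∀ i, Fin (m i) → ℝ) :
    correctLinear S G g Pm l (xm, y) = correct S G g Pm xm y l := rfl

/-- Exact common predictions with noiseless measurements are not changed by the correction. -/
theorem correct_const (x : Fin n → ℝ) (l : ℕ) :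
    correct S G g Pm (fun _ => x) (fun i => S.H i *ᵥ x) l = fun _ => x := by
  have h : ∀ l, (estStep S G g Pm (fun _ => x) (fun i => S.H i *ᵥ x))^[l] (0, fun _ => x) =
      (0, fun _ => x) := by
    intro l
    induction l with
    | zero => rfl
    | succ l ih =>
      rw [Function.iterate_succ_apply', ih]
      have h1 : (estStep S G g Pm (fun _ => x) (fun i => S.H i *ᵥ x) (0, fun _ => x)).1 = 0 := by
        funext i
        simp [estStep, disagreement_const]
      refine Prod.ext h1 (funext fun i => ?_)
      change x + Kinno S i (Pm i) *ᵥ (S.H i *ᵥ x - S.H i *ᵥ x) - Kcons S i (Pm i) *ᵥ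
        G.disagreement (estStep S G g Pm (fun _ => x) (fun i => S.H i *ᵥ x) (0, fun _ => x)).1 i = x
      rw [h1]
      simp [Network.disagreement]
  exact congrArg Prod.snd (h l)

/-- The error of the correction is the correction of the prediction errors. -/
theorem sub_correct (x : Fin n → ℝ) (xm : Fin N → Fin n → ℝ) (y : ∀ i, Fin (m i) → ℝ) (l : ℕ)
    (i : Fin N) :
    x - correct S G g Pm xm y l i =
      correctLinear S G g Pm l (fun j => x - xm j, fun j => S.H j *ᵥ x - y j) i := by
  have h := (correctLinear S G g Pm l).map_sub (fun _ => x, fun j => S.H j *ᵥ x) (xm, y)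
  rw [correctLinear_apply, correctLinear_apply, correct_const] at h
  exact (congrFun h i).symm

variable {S G g Pm}

theorem Kcons_inv_posDef (hR : ∀ i, (S.R i).PosDef) (i : Fin N) {X : Matrix (Fin n) (Fin n) ℝ}
    (hX : X.PosDef) : (sensorInfo S i + (1 / (N : ℝ)) • X⁻¹).PosDef := by
  have hN : 0 < 1 / (N : ℝ) := by have := i.pos; positivity
  exact (hX.inv.smul hN).posSemidef_add (sensorInfo_posSemidef hR i)

theorem tendsto_correct {α : Type*} {f : Filter α} (hR : ∀ i, (S.R i).PosDef)
    (heps : ∀ i, 0 < g.eps i) {A : α → Fin N → Matrix (Fin n) (Fin n) ℝ}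
    (hPm : ∀ i, (Pm i).PosDef) (hA : ∀ i, Tendsto (fun a => A a i) f (𝓝 (Pm i)))
    (xm : Fin N → Fin n → ℝ) (y : ∀ i, Fin (m i) → ℝ) (l : ℕ) :
    Tendsto (fun a => correct S G g (A a) xm y l) f (𝓝 (correct S G g Pm xm y l)) := by
  have hK : ∀ i, Tendsto (fun a => Kcons S i (A a i)) f (𝓝 (Kcons S i (Pm i))) := fun i =>
    tendsto_matrix_inv (Kcons_inv_posDef hR i (hPm i))
      (((tendsto_matrix_inv (hPm i) (hA i)).const_smul _).const_add _)
  have hD : ∀ i, Tendsto (fun a => Kdual g i (A a i)) f (𝓝 (Kdual g i (Pm i))) := fun i => by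
    have hc : Continuous fun M : Matrix (Fin n) (Fin n) ℝ =>
        Matrix.toEuclideanCLM (n := Fin n) (𝕜 := ℝ) ((N : ℝ) • M) :=
      (LinearMap.continuous_of_finiteDimensional
        (Matrix.toEuclideanCLM (n := Fin n) (𝕜 := ℝ)).toAlgEquiv.toLinearMap).comp
        (continuous_const_smul (N : ℝ))
    have h1 := ((hc.norm.tendsto (Pm i)).comp (hA i)).add_const (g.eps i)
    refine tendsto_const_nhds.div h1 ?_
    have := heps i
    positivity
  have hmv : ∀ {p q : ℕ} {B : α → Matrix (Fin p) (Fin q) ℝ} {B' : Matrix (Fin p) (Fin q) ℝ}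
      {v : α → Fin q → ℝ} {v' : Fin q → ℝ}, Tendsto B f (𝓝 B') → Tendsto v f (𝓝 v') →
      Tendsto (fun a => B a *ᵥ v a) f (𝓝 (B' *ᵥ v')) := fun {p q B B' v v'} h1 h2 => by
    have hc : Continuous fun s : Matrix (Fin p) (Fin q) ℝ × (Fin q → ℝ) => s.1 *ᵥ s.2 :=
      continuous_fst.matrix_mulVec continuous_snd
    exact (hc.tendsto (B', v')).comp (h1.prodMk_nhds h2)
  have hdis : ∀ {z : α → Fin N → Fin n → ℝ} {z' : Fin N → Fin n → ℝ}, Tendsto z f (𝓝 z') →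
      ∀ i, Tendsto (fun a => G.disagreement (z a) i) f (𝓝 (G.disagreement z' i)) := by
    intro z z' h i
    refine tendsto_finsetSum _ fun j _ => Tendsto.const_smul ?_ _
    exact (tendsto_pi_nhds.mp h i).sub (tendsto_pi_nhds.mp h j)
  have key : ∀ l : ℕ, Tendsto (fun a => (estStep S G g (A a) xm y)^[l] (0, xm)) f
      (𝓝 ((estStep S G g Pm xm y)^[l] (0, xm))) := by
    intro l
    induction l with
    | zero => exact tendsto_const_nhds
    | succ l ih =>
      simp only [Function.iterate_succ_apply']
      set s := fun a => (estStep S G g (A a) xm y)^[l] (0, xm)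
      set s' := (estStep S G g Pm xm y)^[l] (0, xm)
      have h1 : Tendsto (fun a => (s a).1) f (𝓝 s'.1) := (continuous_fst.tendsto _).comp ih
      have h2 : Tendsto (fun a => (s a).2) f (𝓝 s'.2) := (continuous_snd.tendsto _).comp ih
      have h3 : Tendsto (fun a => (estStep S G g (A a) xm y (s a)).1) f
          (𝓝 (estStep S G g Pm xm y s').1) := by
        refine tendsto_pi_nhds.mpr fun i => ?_
        exact (tendsto_pi_nhds.mp h1 i).add (((hD i).const_mul _).smul (hdis h2 i))
      refine h3.prodMk_nhds (tendsto_pi_nhds.mpr fun i => ?_)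
      refine (tendsto_const_nhds.add (hmv ?_ tendsto_const_nhds)).sub (hmv (hK i) (hdis h3 i))
      have hc : Continuous fun M : Matrix (Fin n) (Fin n) ℝ => M * (S.H i)ᵀ * (S.R i)⁻¹ :=
        (continuous_id.matrix_mul continuous_const).matrix_mul continuous_const
      exact (hc.tendsto _).comp (hK i)
  exact (continuous_snd.tendsto _).comp (key l)

/-- The block diagonal matrix acting on stacked vectors. -/
def blockMat (A : Fin N → Matrix (Fin n) (Fin n) ℝ) :
    Matrix (Fin N × Fin n) (Fin N × Fin n) ℝ :=
  Matrix.of fun p q => if p.1 = q.1 then A p.1 p.2 q.2 else 0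

theorem blockMat_mulVec (A : Fin N → Matrix (Fin n) (Fin n) ℝ) (z : Fin N × Fin n → ℝ)
    (p : Fin N × Fin n) : (blockMat A *ᵥ z) p = (A p.1 *ᵥ fun a => z (p.1, a)) p.2 := by
  simp [Matrix.mulVec, dotProduct, blockMat, Fintype.sum_prod_type, ite_mul]

theorem dotProduct_blockMat (A : Fin N → Matrix (Fin n) (Fin n) ℝ) (z : Fin N × Fin n → ℝ) :
    z ⬝ᵥ blockMat A *ᵥ z = ∑ i, (fun a => z (i, a)) ⬝ᵥ A i *ᵥ (fun a => z (i, a)) := by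
  simp only [dotProduct, blockMat_mulVec, Fintype.sum_prod_type]

theorem blockMat_isHermitian {A : Fin N → Matrix (Fin n) (Fin n) ℝ}
    (hA : ∀ i, (A i).IsHermitian) : (blockMat A).IsHermitian := by
  ext p q
  simp only [blockMat, Matrix.conjTranspose_apply, Matrix.of_apply, star_trivial]
  by_cases h : p.1 = q.1
  · rw [if_pos h, if_pos h.symm, h]
    simpa using (hA q.1).apply p.2 q.2
  · rw [if_neg h, if_neg (Ne.symm h)]

theorem blockMat_posDef {A : Fin N → Matrix (Fin n) (Fin n) ℝ} (hA : ∀ i, (A i).PosDef) :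
    (blockMat A).PosDef := by
  refine posDef_of_forall_dotProduct (blockMat_isHermitian fun i => (hA i).isHermitian)
    fun z hz => ?_
  rw [dotProduct_blockMat]
  obtain ⟨p, hp⟩ := Function.ne_iff.mp hz
  refine Finset.sum_pos' (fun i _ => dotProduct_nonneg (hA i).posSemidef _)
    ⟨p.1, Finset.mem_univ _, dotProduct_pos (hA p.1) fun h => hp (congrFun h p.2)⟩

theorem blockMat_le_smul_one {A : Fin N → Matrix (Fin n) (Fin n) ℝ} {c : ℝ}
    (hA : ∀ i, (A i).IsHermitian) (h : ∀ i, A i ≤ c • 1) : blockMat A ≤ c • 1 := by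
  refine le_of_forall_dotProduct (blockMat_isHermitian hA) (by simp [Matrix.IsHermitian])
    fun z => ?_
  rw [dotProduct_blockMat, Matrix.smul_mulVec, Matrix.one_mulVec, dotProduct_smul, smul_eq_mul]
  have : z ⬝ᵥ z = ∑ i, (fun a => z (i, a)) ⬝ᵥ (fun a => z (i, a)) := by
    simp only [dotProduct, Fintype.sum_prod_type]
  rw [this, Finset.mul_sum]
  refine Finset.sum_le_sum fun i _ => ?_
  have := dotProduct_le_of_le (h i) (fun a => z (i, a))
  simpa [Matrix.smul_mulVec] using this

/-- The blockwise Laplacian `L ⊗ I`. -/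
def blockLaplacian (G : Network N) (n : ℕ) : Matrix (Fin N × Fin n) (Fin N × Fin n) ℝ :=
  Matrix.blockDiagonal fun _ : Fin n => G.laplacian

theorem blockLaplacian_mulVec' (z : Fin N × Fin n → ℝ) (p : Fin N × Fin n) :
    (blockLaplacian G n *ᵥ z) p = (G.laplacian *ᵥ fun j => z (j, p.2)) p.1 := by
  simp [Matrix.mulVec, dotProduct, blockLaplacian, Matrix.blockDiagonal_apply,
    Fintype.sum_prod_type, ite_mul]

theorem blockLaplacian_mulVec (z : Fin N → Fin n → ℝ) (p : Fin N × Fin n) :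
    (blockLaplacian G n *ᵥ Function.uncurry z) p = G.disagreement z p.1 p.2 := by
  rw [blockLaplacian_mulVec', Network.laplacian_mulVec]
  simp [Network.disagreement, Finset.sum_apply, Function.uncurry]

theorem blockLaplacian_transpose : (blockLaplacian G n)ᵀ = blockLaplacian G n := by
  rw [blockLaplacian, Matrix.blockDiagonal_transpose]
  simp only [G.laplacian_transpose]

theorem blockLaplacian_sq_le {σ : ℝ}
    (hσ : ∀ s : ℝ, Module.End.HasEigenvalue (Matrix.toLin' G.laplacian) s → s ≤ σ)
    (z : Fin N × Fin n → ℝ) :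
    (blockLaplacian G n *ᵥ z) ⬝ᵥ (blockLaplacian G n *ᵥ z) ≤ σ ^ 2 * (z ⬝ᵥ z) := by
  simp only [dotProduct, blockLaplacian_mulVec', Fintype.sum_prod_type_right]
  rw [Finset.mul_sum]
  exact Finset.sum_le_sum fun a _ => G.laplacian_sq_le hσ fun j => z (j, a)

section SteadyState

variable {X : Matrix (Fin n) (Fin n) ℝ}

theorem correct_succ (e : Fin N → Fin n → ℝ) (l : ℕ) (i : Fin N) :
    correct S G g Pm e 0 (l + 1) i = e i + Kinno S i (Pm i) *ᵥ (0 - S.H i *ᵥ e i)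
      - Kcons S i (Pm i) *ᵥ
        G.disagreement ((estStep S G g Pm e 0)^[l + 1] (0, e)).1 i := by
  rw [correct, Function.iterate_succ_apply']
  rfl

theorem correct_add_two (e : Fin N → Fin n → ℝ) (l : ℕ) (i : Fin N) :
    correct S G g Pm e 0 (l + 2) i = correct S G g Pm e 0 (l + 1) i - Kcons S i (Pm i) *ᵥ
      G.disagreement (fun j => (g.alphaLam j * Kdual g j (Pm j)) •
        G.disagreement (correct S G g Pm e 0 (l + 1)) j) i := by
  rw [correct_succ, correct_succ]
  have h : ((estStep S G g Pm e 0)^[l + 1 + 1] (0, e)).1 =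
      ((estStep S G g Pm e 0)^[l + 1] (0, e)).1 + fun j => (g.alphaLam j * Kdual g j (Pm j)) •
        G.disagreement (correct S G g Pm e 0 (l + 1)) j := by
    rw [Function.iterate_succ_apply']
    rfl
  rw [h, disagreement_add, Matrix.mulVec_add]
  abel

theorem uncurry_correct (e : Fin N → Fin n → ℝ) (l : ℕ) :
    Function.uncurry (correct S G g Pm e 0 (l + 1)) =
      (1 - blockMat (fun i => Kcons S i (Pm i)) * (blockLaplacian G n *
        Matrix.diagonal (fun p => g.alphaLam p.1 * Kdual g p.1 (Pm p.1)) *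
        blockLaplacian G n)) ^ l *ᵥ Function.uncurry (correct S G g Pm e 0 1) := by
  induction l with
  | zero => simp
  | succ l ih =>
    rw [pow_succ', ← Matrix.mulVec_mulVec, ← ih, Matrix.sub_mulVec, Matrix.one_mulVec]
    funext p
    rw [Pi.sub_apply, ← Matrix.mulVec_mulVec, ← Matrix.mulVec_mulVec, ← Matrix.mulVec_mulVec,
      blockMat_mulVec]
    have h1 : Matrix.diagonal (fun p : Fin N × Fin n => g.alphaLam p.1 * Kdual g p.1 (Pm p.1)) *ᵥ
        (blockLaplacian G n *ᵥ Function.uncurry (correct S G g Pm e 0 (l + 1))) =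
        Function.uncurry (fun j => (g.alphaLam j * Kdual g j (Pm j)) •
          G.disagreement (correct S G g Pm e 0 (l + 1)) j) := by
      funext q
      rw [Matrix.mulVec_diagonal, blockLaplacian_mulVec]
      rfl
    rw [h1]
    simp only [blockLaplacian_mulVec]
    exact congrFun (correct_add_two e l p.1) p.2

theorem sum_mulVec_correct (hR : ∀ i, (S.R i).PosDef) (hX : X.PosDef) (e : Fin N → Fin n → ℝ)
    (l : ℕ) :
    ∑ i, (sensorInfo S i + (1 / (N : ℝ)) • X⁻¹) *ᵥ
      correct S G g (fun _ => X) e 0 (l + 1) i = X⁻¹ *ᵥ ((1 / (N : ℝ)) • ∑ i, e i) := by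
  have h : ∀ i, (sensorInfo S i + (1 / (N : ℝ)) • X⁻¹) *ᵥ
      correct S G g (fun _ => X) e 0 (l + 1) i = X⁻¹ *ᵥ ((1 / (N : ℝ)) • e i) -
        G.disagreement ((estStep S G g (fun _ => X) e 0)^[l + 1] (0, e)).1 i := fun i => by
    have hJ := Kcons_inv_posDef hR i hX
    have hK : Kcons S i X = (sensorInfo S i + (1 / (N : ℝ)) • X⁻¹)⁻¹ := rfl
    have h2 : Kinno S i X *ᵥ (0 - S.H i *ᵥ e i) = -(Kcons S i X *ᵥ (sensorInfo S i *ᵥ e i)) := by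
      rw [zero_sub, Matrix.mulVec_neg, Kinno, sensorInfo]
      simp only [Matrix.mulVec_mulVec, Matrix.mul_assoc]
    rw [correct_succ, h2, hK, Matrix.mulVec_sub, Matrix.mulVec_add, Matrix.mulVec_neg,
      mulVec_inv_mulVec hJ, mulVec_inv_mulVec hJ, Matrix.add_mulVec, Matrix.smul_mulVec,
      Matrix.mulVec_smul]
    abel
  rw [Finset.sum_congr rfl fun i _ => h i, Finset.sum_sub_distrib, Network.sum_disagreement,
    Finset.smul_sum, Matrix.mulVec_sum]
  simp

/-- With the common covariance `X`, the subiterations converge to the centralized correction. -/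
theorem tendsto_correct_subiterations (hR : ∀ i, (S.R i).PosDef) (hconn : G.graph.Connected)
    {σ : ℝ} (hσ0 : 0 < σ)
    (hσ : ∀ s : ℝ, Module.End.HasEigenvalue (Matrix.toLin' G.laplacian) s → s ≤ σ)
    (heps : ∀ i, 0 < g.eps i) (hlam : ∀ i, 0 < g.alphaLam i ∧ g.alphaLam i < 2 / σ ^ 2)
    (hX : X.PosDef) (e : Fin N → Fin n → ℝ) :
    Tendsto (fun l => correct S G g (fun _ => X) e 0 l) atTop
      (𝓝 fun _ => (X⁻¹ + totalInfo S)⁻¹ *ᵥ (X⁻¹ *ᵥ ((1 / (N : ℝ)) • ∑ i, e i))) := by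
  have : Nonempty (Fin N) := hconn.nonempty
  have hN : 0 < (N : ℝ) := by
    have : 0 < N := (Classical.arbitrary (Fin N)).pos
    positivity
  obtain ⟨i₀, hi₀⟩ := Finite.exists_min g.eps
  set ν := ‖Matrix.toEuclideanCLM (n := Fin n) (𝕜 := ℝ) ((N : ℝ) • X)‖ with hν
  have hν0 : 0 ≤ ν := norm_nonneg _
  have hη := heps i₀
  have hJ := fun i => Kcons_inv_posDef hR i hX
  have hKle : ∀ i, Kcons S i X ≤ (ν + g.eps i₀) • 1 := fun i => by
    have h1 : (1 / (N : ℝ)) • X⁻¹ ≤ sensorInfo S i + (1 / (N : ℝ)) • X⁻¹ := by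
      simpa using (sensorInfo_posSemidef hR i).nonneg
    have h2 := inv_le_inv_of_le (hX.inv.smul (one_div_pos.mpr hN)) h1
    rw [inv_smul_pos (one_div_pos.mpr hN), posDef_inv_inv hX,
      show (1 / (N : ℝ))⁻¹ = N by simp] at h2
    refine h2.trans ((le_norm_smul_one (hX.smul hN).isHermitian).trans ?_)
    exact smul_le_smul_of_nonneg_right (by linarith) Matrix.PosSemidef.one.nonneg
  obtain ⟨P, hP, hLP⟩ := exists_tendsto_dualAscent
    (K := blockMat fun i => Kcons S i X) (L := blockLaplacian G n)
    (d := fun p => g.alphaLam p.1 * Kdual g p.1 X) (c := ν + g.eps i₀)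
    (blockMat_posDef fun i => (hJ i).inv) blockLaplacian_transpose hσ0 (blockLaplacian_sq_le hσ)
    (by linarith) (blockMat_le_smul_one (fun i => (hJ i).inv.isHermitian) hKle)
    (fun p => by
      have := heps p.1
      have := (hlam p.1).1
      unfold Kdual
      positivity)
    (fun p => by
      refine lt_of_le_of_lt ?_ (hlam p.1).2
      have h1 := heps p.1
      have h2 := (hlam p.1).1
      have h3 : Kdual g p.1 X * (ν + g.eps i₀) ≤ 1 := by
        rw [Kdual, ← hν, div_mul_eq_mul_div, one_mul]
        exact (div_le_one (by linarith)).mpr (by linarith [hi₀ p.1])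
      rw [mul_assoc]
      nlinarith)
  set z := fun l => correct S G g (fun _ => X) e 0 (l + 1)
  set zlim := P *ᵥ Function.uncurry (correct S G g (fun _ => X) e 0 1)
  have hz : Tendsto (fun l => Function.uncurry (z l)) atTop (𝓝 zlim) := by
    have hc : Continuous fun M : Matrix (Fin N × Fin n) (Fin N × Fin n) ℝ =>
        M *ᵥ Function.uncurry (correct S G g (fun _ => X) e 0 1) :=
      continuous_id.matrix_mulVec continuous_const
    exact ((hc.tendsto P).comp hP).congr fun l => (uncurry_correct e l).symm
  have hLz : blockLaplacian G n *ᵥ zlim = 0 := by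
    rw [Matrix.mulVec_mulVec, hLP, Matrix.zero_mulVec]
  have hcons : ∀ a i j, zlim (i, a) = zlim (j, a) := fun a i j => by
    refine G.eq_of_laplacian_mulVec_eq_zero hconn (x := fun j => zlim (j, a)) ?_ i j
    funext i'
    rw [← blockLaplacian_mulVec' zlim (i', a), hLz]
    rfl
  set s : Fin n → ℝ := fun a => zlim (i₀, a)
  have hzs : Tendsto z atTop (𝓝 fun _ => s) := by
    refine tendsto_pi_nhds.mpr fun i => tendsto_pi_nhds.mpr fun a => ?_
    have := tendsto_pi_nhds.mp hz (i, a)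
    rwa [hcons a i i₀] at this
  have hsum : Tendsto (fun l => ∑ i, (sensorInfo S i + (1 / (N : ℝ)) • X⁻¹) *ᵥ z l i) atTop
      (𝓝 (∑ i, (sensorInfo S i + (1 / (N : ℝ)) • X⁻¹) *ᵥ s)) := by
    refine tendsto_finsetSum _ fun i _ => ?_
    have hc : Continuous fun v : Fin n → ℝ => (sensorInfo S i + (1 / (N : ℝ)) • X⁻¹) *ᵥ v :=
      continuous_const.matrix_mulVec continuous_id
    exact (hc.tendsto _).comp (tendsto_pi_nhds.mp hzs i)
  have hs1 : ∑ i, (sensorInfo S i + (1 / (N : ℝ)) • X⁻¹) *ᵥ s =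
      X⁻¹ *ᵥ ((1 / (N : ℝ)) • ∑ i, e i) := by
    refine tendsto_nhds_unique hsum (tendsto_const_nhds.congr fun l => ?_)
    exact (sum_mulVec_correct (G := G) (g := g) hR hX e l).symm
  have hs2 : ∑ i, (sensorInfo S i + (1 / (N : ℝ)) • X⁻¹) *ᵥ s = (X⁻¹ + totalInfo S) *ᵥ s := by
    rw [← Matrix.sum_mulVec, Finset.sum_add_distrib, add_comm, totalInfo, Finset.sum_const,
      Finset.card_univ, Fintype.card_fin, ← Nat.cast_smul_eq_nsmul ℝ, smul_smul,
      mul_one_div_cancel hN.ne', one_smul]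
  have hs : s = (X⁻¹ + totalInfo S)⁻¹ *ᵥ (X⁻¹ *ᵥ ((1 / (N : ℝ)) • ∑ i, e i)) := by
    rw [← hs1, hs2, inv_mulVec_mulVec (hX.inv.add_posSemidef (totalInfo_posSemidef hR))]
  rw [← hs]
  exact (tendsto_add_atTop_iff_nat 1).mp hzs

end SteadyState

end Estimates

section Stability

open scoped MatrixOrder

theorem tendsto_clm_of_tendsto_apply {α V W : Type*} [NormedAddCommGroup V] [NormedSpace ℝ V]
    [FiniteDimensional ℝ V] [NormedAddCommGroup W] [NormedSpace ℝ W] {f : Filter α}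
    {A : α → V →L[ℝ] W} {B : V →L[ℝ] W} (h : ∀ v, Tendsto (fun a => A a v) f (𝓝 (B v))) :
    Tendsto A f (𝓝 B) := by
  let e : (V →L[ℝ] W) ≃L[ℝ] Fin (Module.finrank ℝ V) → W :=
    ((ContinuousLinearEquiv.ofFinrankEq (Module.finrank_fin_fun ℝ).symm).arrowCongr
      (1 : W ≃L[ℝ] W)).trans (ContinuousLinearEquiv.piRing _)
  rw [e.toHomeomorph.isInducing.tendsto_nhds_iff]
  exact tendsto_pi_nhds.mpr fun i => h _

section Contraction

variable {V E : Type*} [NormedAddCommGroup V] [NormedSpace ℝ V]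
  [NormedAddCommGroup E] [NormedSpace ℝ E]

/-- The operator norm with respect to the norm transported along `T`. -/
noncomputable def transportedNorm (T : V ≃L[ℝ] E) (A : V →L[ℝ] V) : ℝ :=
  ‖(T : V →L[ℝ] E) ∘L A ∘L (T.symm : E →L[ℝ] V)‖

theorem tendsto_transportedNorm {α : Type*} {f : Filter α} (T : V ≃L[ℝ] E) {A : α → V →L[ℝ] V}
    {B : V →L[ℝ] V} (h : Tendsto A f (𝓝 B)) :
    Tendsto (fun a => transportedNorm T (A a)) f (𝓝 (transportedNorm T B)) := by
  have hc : Continuous fun A : V →L[ℝ] V => transportedNorm T A :=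
    (continuous_const.clm_comp (continuous_id.clm_comp continuous_const)).norm
  exact (hc.tendsto B).comp h

theorem tendsto_zero_of_transportedNorm (T : V ≃L[ℝ] E) {A : ℕ → V →L[ℝ] V} {r : ℝ} (hr : r < 1)
    (hA : ∀ᶠ k in atTop, transportedNorm T (A k) ≤ r) {e : ℕ → V}
    (he : ∀ k, e (k + 1) = A k (e k)) : Tendsto e atTop (𝓝 0) := by
  obtain ⟨K, hK⟩ := eventually_atTop.mp hA
  have hr0 : 0 ≤ r := (norm_nonneg _).trans (hK K le_rfl)
  have hb : ∀ j, ‖T (e (K + j))‖ ≤ r ^ j * ‖T (e K)‖ := fun j => by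
    induction j with
    | zero => simp
    | succ j ih =>
      have h1 := ((T : V →L[ℝ] E) ∘L A (K + j) ∘L (T.symm : E →L[ℝ] V)).le_opNorm (T (e (K + j)))
      simp only [ContinuousLinearMap.comp_apply, ContinuousLinearEquiv.coe_coe,
        ContinuousLinearEquiv.symm_apply_apply] at h1
      rw [← he] at h1
      calc ‖T (e (K + j + 1))‖ ≤ _ := h1
        _ ≤ r * (r ^ j * ‖T (e K)‖) :=
          mul_le_mul (hK (K + j) (by omega)) ih (norm_nonneg _) hr0
        _ = r ^ (j + 1) * ‖T (e K)‖ := by ring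
  have h2 : Tendsto (fun j => T (e (K + j))) atTop (𝓝 0) := by
    refine squeeze_zero_norm hb ?_
    simpa using (tendsto_pow_atTop_nhds_zero_of_lt_one hr0 hr).mul_const ‖T (e K)‖
  have h3 : Tendsto (fun j => e (j + K)) atTop (𝓝 0) := by
    have := (T.symm.continuous.tendsto 0).comp h2
    simpa [Function.comp_def, add_comm K] using this
  exact (tendsto_add_atTop_iff_nat K).mp h3

end Contraction

variable {N n : ℕ} {m : Fin N → ℕ}

/-- A Euclidean norm on stacked vectors that is weighted by a positive definite matrix. -/
theorem exists_weighted_equiv (N : ℕ) {Y : Matrix (Fin n) (Fin n) ℝ} (hY : Y.PosDef) :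
    ∃ T : (Fin N → Fin n → ℝ) ≃L[ℝ] EuclideanSpace ℝ (Fin N × Fin n),
      ∀ e, ‖T e‖ ^ 2 = ∑ i, e i ⬝ᵥ Y *ᵥ e i := by
  obtain ⟨B, hB⟩ := CStarAlgebra.nonneg_iff_eq_star_mul_self.mp hY.posSemidef.nonneg
  have hB' : Y = Bᵀ * B := by
    rw [hB, Matrix.star_eq_conjTranspose, Matrix.conjTranspose_eq_transpose_of_trivial]
  have hYdet : IsUnit Y.det := (Matrix.isUnit_iff_isUnit_det Y).mp hY.isUnit
  have hBdet : IsUnit B.det := by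
    rw [hB', Matrix.det_mul, Matrix.det_transpose] at hYdet
    exact isUnit_of_mul_isUnit_left hYdet
  let T : (Fin N → Fin n → ℝ) ≃ₗ[ℝ] EuclideanSpace ℝ (Fin N × Fin n) :=
    { toFun := fun e => WithLp.toLp 2 fun p => (B *ᵥ e p.1) p.2
      invFun := fun x i => B⁻¹ *ᵥ fun a => x (i, a)
      map_add' := fun e e' => by ext p; simp [Matrix.mulVec_add]
      map_smul' := fun c e => by ext p; simp [Matrix.mulVec_smul]
      left_inv := fun e => by
        funext i
        change B⁻¹ *ᵥ (B *ᵥ e i) = e i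
        rw [Matrix.mulVec_mulVec, Matrix.nonsing_inv_mul _ hBdet, Matrix.one_mulVec]
      right_inv := fun x => by
        ext p
        change (B *ᵥ (B⁻¹ *ᵥ fun a => x (p.1, a))) p.2 = x p
        rw [Matrix.mulVec_mulVec, Matrix.mul_nonsing_inv _ hBdet, Matrix.one_mulVec] }
  refine ⟨T.toContinuousLinearEquiv, fun e => ?_⟩
  change ‖WithLp.toLp 2 fun p : Fin N × Fin n => (B *ᵥ e p.1) p.2‖ ^ 2 = _
  rw [norm_sq_toLp]
  have h : ∀ v : Fin n → ℝ, v ⬝ᵥ Y *ᵥ v = (B *ᵥ v) ⬝ᵥ (B *ᵥ v) := fun v => by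
    rw [hB', ← Matrix.mulVec_mulVec, Matrix.dotProduct_transpose_mulVec, dotProduct_comm]
  simp only [h]
  simp only [dotProduct, Fintype.sum_prod_type]

/-- Averaging does not increase the sum of a quadratic form. -/
theorem sum_dotProduct_average_le {Y : Matrix (Fin n) (Fin n) ℝ} (hY : Y.PosSemidef)
    (hN : 0 < N) (e : Fin N → Fin n → ℝ) :
    (N : ℝ) * (((1 / (N : ℝ)) • ∑ i, e i) ⬝ᵥ Y *ᵥ ((1 / (N : ℝ)) • ∑ i, e i)) ≤
      ∑ i, e i ⬝ᵥ Y *ᵥ e i := by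
  have hN' : (N : ℝ) ≠ 0 := by positivity
  set a := (1 / (N : ℝ)) • ∑ i, e i with ha
  have hsum : ∑ i, e i = (N : ℝ) • a := by rw [ha, smul_smul, mul_one_div_cancel hN', one_smul]
  have h0 : 0 ≤ ∑ i, (e i - a) ⬝ᵥ Y *ᵥ (e i - a) :=
    Finset.sum_nonneg fun i _ => dotProduct_nonneg hY _
  have h1 : ∀ i, (e i - a) ⬝ᵥ Y *ᵥ (e i - a) =
      e i ⬝ᵥ Y *ᵥ e i - 2 * (e i ⬝ᵥ Y *ᵥ a) + a ⬝ᵥ Y *ᵥ a := fun i => by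
    rw [Matrix.mulVec_sub, dotProduct_sub, sub_dotProduct, sub_dotProduct,
      dotProduct_mulVec_comm hY.isHermitian a (e i)]
    ring
  rw [Finset.sum_congr rfl fun i _ => h1 i, Finset.sum_add_distrib, Finset.sum_sub_distrib,
    ← Finset.mul_sum, ← sum_dotProduct, hsum, smul_dotProduct] at h0
  simp only [Finset.sum_const, Finset.card_univ, Fintype.card_fin, nsmul_eq_mul, smul_eq_mul] at h0
  linarith

/-- The mean prediction error at the next time as a function of the present one. -/
noncomputable def errorMap (S : LinSystem N n m) (G : Network N) (g : Gains N)
    (Pm : Fin N → Matrix (Fin n) (Fin n) ℝ) (l : ℕ) :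
    (Fin N → Fin n → ℝ) →L[ℝ] (Fin N → Fin n → ℝ) :=
  LinearMap.toContinuousLinearMap (LinearMap.pi fun i =>
    S.F.mulVecLin ∘ₗ LinearMap.proj i ∘ₗ correctLinear S G g Pm l ∘ₗ LinearMap.inl ℝ _ _)

/-- The error map of the centralized steady-state filter. -/
noncomputable def centralErrorMap (S : LinSystem N n m) (X : Matrix (Fin n) (Fin n) ℝ) :
    (Fin N → Fin n → ℝ) →L[ℝ] (Fin N → Fin n → ℝ) :=
  LinearMap.toContinuousLinearMap (LinearMap.pi fun _ =>
    S.F.mulVecLin ∘ₗ ((X⁻¹ + totalInfo S)⁻¹).mulVecLin ∘ₗ (X⁻¹).mulVecLin ∘ₗ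
      ((1 / (N : ℝ)) • ∑ i, LinearMap.proj i))

theorem centralErrorMap_apply (S : LinSystem N n m) (X : Matrix (Fin n) (Fin n) ℝ)
    (e : Fin N → Fin n → ℝ) :
    centralErrorMap S X e = fun _ => S.F *ᵥ ((X⁻¹ + totalInfo S)⁻¹ *ᵥ
      (X⁻¹ *ᵥ ((1 / (N : ℝ)) • ∑ i, e i))) := by
  funext i
  simp [centralErrorMap, Matrix.mulVec_smul, Matrix.mulVec_sum]

theorem tendsto_mulVec_pi {α : Type*} {f : Filter α} (F : Matrix (Fin n) (Fin n) ℝ)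
    {z : α → Fin N → Fin n → ℝ} {z' : Fin N → Fin n → ℝ} (h : Tendsto z f (𝓝 z')) :
    Tendsto (fun a i => F *ᵥ z a i) f (𝓝 fun i => F *ᵥ z' i) := by
  refine tendsto_pi_nhds.mpr fun i => ?_
  have hc : Continuous fun v : Fin n → ℝ => F *ᵥ v := continuous_const.matrix_mulVec continuous_id
  exact (hc.tendsto _).comp (tendsto_pi_nhds.mp h i)

theorem exists_transportedNorm_central_lt_one {S : LinSystem N n m} (hQ : S.Q.PosDef)
    (hR : ∀ i, (S.R i).PosDef) (hN : 0 < N) {X : Matrix (Fin n) (Fin n) ℝ} (hX : X.PosDef)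
    (hfix : riccati S.F S.Q (totalInfo S) X = X) :
    ∃ T : (Fin N → Fin n → ℝ) ≃L[ℝ] EuclideanSpace ℝ (Fin N × Fin n),
      transportedNorm T (centralErrorMap S X) < 1 := by
  obtain ⟨T, hT⟩ := exists_weighted_equiv N hX.inv
  obtain ⟨c, hc0, hc1, hc⟩ := exists_smul_le_of_posDef hQ hX
  refine ⟨T, ?_⟩
  have hs : Real.sqrt (1 - c) < 1 := by
    rw [Real.sqrt_lt' one_pos]; linarith
  refine lt_of_le_of_lt (ContinuousLinearMap.opNorm_le_bound _ (Real.sqrt_nonneg _) fun x => ?_) hs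
  obtain ⟨e, rfl⟩ := T.surjective x
  simp only [ContinuousLinearMap.comp_apply, ContinuousLinearEquiv.coe_coe,
    ContinuousLinearEquiv.symm_apply_apply]
  refine le_of_sq_le_sq ?_ (by positivity)
  rw [mul_pow, Real.sq_sqrt (by linarith), hT, hT, centralErrorMap_apply]
  simp only [Finset.sum_const, Finset.card_univ, Fintype.card_fin, nsmul_eq_mul]
  have h1 := closedLoop_contraction (totalInfo_posSemidef hR) hX hfix (by linarith) hc
    ((1 / (N : ℝ)) • ∑ i, e i)
  have h2 := sum_dotProduct_average_le hX.inv.posSemidef hN e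
  calc _ ≤ (N : ℝ) * ((1 - c) * (((1 / (N : ℝ)) • ∑ i, e i) ⬝ᵥ
        X⁻¹ *ᵥ ((1 / (N : ℝ)) • ∑ i, e i))) :=
      mul_le_mul_of_nonneg_left h1 (Nat.cast_nonneg _)
    _ = (1 - c) * ((N : ℝ) * (((1 / (N : ℝ)) • ∑ i, e i) ⬝ᵥ
        X⁻¹ *ᵥ ((1 / (N : ℝ)) • ∑ i, e i))) := by ring
    _ ≤ _ := mul_le_mul_of_nonneg_left h2 (by linarith)

/-- The predicted covariances used at time `k + 1`. -/
noncomputable def predictedCov (S : LinSystem N n m) (G : Network N) (g : Gains N) (lstar : ℕ)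
    (Phat0 : Fin N → Matrix (Fin n) (Fin n) ℝ) (k : ℕ) (i : Fin N) : Matrix (Fin n) (Fin n) ℝ :=
  predictCov S (localCov S G g lstar Phat0 k i)

/-- The covariances stay positive definite and the mean error dynamics is asymptotically stable. -/
theorem exists_lbar_stable {S : LinSystem N n m} (hQ : S.Q.PosDef) (hR : ∀ i, (S.R i).PosDef)
    (hobs : S.Observable) {G : Network N} (hconn : G.graph.Connected)
    {σ : ℝ} (hσ0 : 0 < σ)
    (hσ : ∀ s : ℝ, Module.End.HasEigenvalue (Matrix.toLin' G.laplacian) s → s ≤ σ)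
    {g : Gains N} (heps : ∀ i, 0 < g.eps i)
    (hlam : ∀ i, 0 < g.alphaLam i ∧ g.alphaLam i < 2 / σ ^ 2)
    (hups : ∀ i, 0 < g.alphaUps i ∧ g.alphaUps i < 2 / σ ^ 2) :
    ∃ lbar : ℕ, ∀ lstar : ℕ, lbar ≤ lstar → ∀ Phat0 : Fin N → Matrix (Fin n) (Fin n) ℝ,
      (∀ i, (Phat0 i).PosDef) →
      (∀ k i, (localCov S G g lstar Phat0 k i).PosDef) ∧
      ∀ e : ℕ → Fin N → Fin n → ℝ,
        (∀ k, e (k + 1) = fun i =>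
          S.F *ᵥ correct S G g (predictedCov S G g lstar Phat0 k) (e k) 0 lstar i) →
        Tendsto (fun k => correct S G g (predictedCov S G g lstar Phat0 k) (e k) 0 lstar)
          atTop (𝓝 0) := by
  have hN : 0 < N := by
    obtain ⟨i⟩ := hconn.nonempty
    exact i.pos
  have hΩ := totalInfo_posSemidef hR
  obtain ⟨X, hX, hfix⟩ := exists_riccati_fixedPoint (F := S.F) hQ hΩ n
    (eq_zero_of_totalInfo hR hobs)
  obtain ⟨T, hT⟩ := exists_transportedNorm_central_lt_one hQ hR hN hX hfix
  obtain ⟨r, hTr, hr⟩ := exists_between hT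
  have hlim : Tendsto (fun l => errorMap S G g (fun _ => X) l) atTop
      (𝓝 (centralErrorMap S X)) := by
    refine tendsto_clm_of_tendsto_apply fun e => ?_
    rw [centralErrorMap_apply]
    exact tendsto_mulVec_pi S.F
      (tendsto_correct_subiterations hR hconn hσ0 hσ heps hlam hX e)
  obtain ⟨l₁, hl₁⟩ := eventually_atTop.mp
    ((tendsto_transportedNorm T hlim).eventually (gt_mem_nhds hTr))
  obtain ⟨l₂, hl₂⟩ := exists_infoRate_bounds hR hconn hσ0 hσ hups
  refine ⟨max l₁ l₂, fun lstar hl Phat0 hP0 => ?_⟩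
  have hinfo := hl₂ lstar ((le_max_right _ _).trans hl)
  have hstep : ∀ k i, predictedCov S G g lstar Phat0 (k + 1) i = riccati S.F S.Q
      (infoRate S G g lstar (k + 1) i) (predictedCov S G g lstar Phat0 k i) := fun k i => rfl
  have hP : ∀ k i, (localCov S G g lstar Phat0 k i).PosDef := fun k => by
    induction k with
    | zero => exact hP0
    | succ k ih =>
      exact fun i => posDef_inv_add_inv (posDef_conj_add hQ (ih i).posSemidef) ((hinfo i).1 k)
  have hXlim : ∀ i, Tendsto (fun k => predictedCov S G g lstar Phat0 k i) atTop (𝓝 X) := fun i =>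
    tendsto_riccati hQ hΩ hX hfix (posDef_conj_add hQ (hP 0 i).posSemidef) (hinfo i).1
      (fun k => hstep k i) (hinfo i).2.1 (hinfo i).2.2
  have hcorr : ∀ e, Tendsto (fun k => correct S G g (predictedCov S G g lstar Phat0 k) e 0 lstar)
      atTop (𝓝 (correct S G g (fun _ => X) e 0 lstar)) := fun e =>
    tendsto_correct hR heps (fun _ => hX) hXlim e 0 lstar
  have hGlim : Tendsto (fun k => errorMap S G g (predictedCov S G g lstar Phat0 k) lstar) atTop
      (𝓝 (errorMap S G g (fun _ => X) lstar)) :=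
    tendsto_clm_of_tendsto_apply fun e => tendsto_mulVec_pi S.F (hcorr e)
  have hcontr := (tendsto_transportedNorm T hGlim).eventually
    (gt_mem_nhds (hl₁ lstar ((le_max_left _ _).trans hl)))
  refine ⟨hP, fun e he => ?_⟩
  have he0 : Tendsto e atTop (𝓝 0) :=
    tendsto_zero_of_transportedNorm T hr (hcontr.mono fun _ h => h.le) he
  let C : (Fin N → Matrix (Fin n) (Fin n) ℝ) → (Fin N → Fin n → ℝ) →L[ℝ] (Fin N → Fin n → ℝ) :=
    fun Pm => LinearMap.toContinuousLinearMap (correctLinear S G g Pm lstar ∘ₗ LinearMap.inl ℝ _ _)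
  have hC : Tendsto (fun k => C (predictedCov S G g lstar Phat0 k)) atTop (𝓝 (C fun _ => X)) :=
    tendsto_clm_of_tendsto_apply hcorr
  have := (isBoundedBilinearMap_apply.continuous.tendsto (C fun _ => X, 0)).comp
    (hC.prodMk_nhds he0)
  simp only [map_zero] at this
  exact this

end Stability

section MeanError

variable {N n : ℕ} {m : Fin N → ℕ} {Ω : Type*} [MeasurableSpace Ω]
  {S : LinSystem N n m} {μ : Measure Ω} [IsProbabilityMeasure μ] {P0 : Matrix (Fin n) (Fin n) ℝ}
  {x0 : Ω → Fin n → ℝ} {w : ℕ → Ω → Fin n → ℝ} {v : ∀ i, ℕ → Ω → Fin (m i) → ℝ}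

theorem IsNoiseModel.integrable_w (h : IsNoiseModel S μ P0 x0 w v) (k : ℕ) :
    Integrable (w k) μ :=
  Integrable.of_eval fun a => (h.gaussian_noise.hasGaussianLaw_eval (k, Sum.inl a)).integrable

theorem IsNoiseModel.integrable_v (h : IsNoiseModel S μ P0 x0 w v) (i : Fin N) (k : ℕ) :
    Integrable (v i k) μ :=
  Integrable.of_eval fun a =>
    (h.gaussian_noise.hasGaussianLaw_eval (k, Sum.inr ⟨i, a⟩)).integrable

theorem IsNoiseModel.integral_w (h : IsNoiseModel S μ P0 x0 w v) (k : ℕ) :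
    ∫ ω, w k ω ∂μ = 0 := by
  funext a
  rw [MeasureTheory.eval_integral fun a => (h.integrable_w k).eval a]
  exact h.mean_w k a

theorem IsNoiseModel.integral_v (h : IsNoiseModel S μ P0 x0 w v) (i : Fin N) (k : ℕ) :
    ∫ ω, v i k ω ∂μ = 0 := by
  funext a
  rw [MeasureTheory.eval_integral fun a => (h.integrable_v i k).eval a]
  exact h.mean_v i k a

variable (S μ x0 w v)

/-- The local estimation errors `x_k - xhat_{i,k}`. -/
noncomputable def estError (G : Network N) (g : Gains N) (lstar : ℕ)
    (Phat0 : Fin N → Matrix (Fin n) (Fin n) ℝ) (xhat0 : Fin N → Fin n → ℝ) (k : ℕ) (ω : Ω)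
    (i : Fin N) : Fin n → ℝ :=
  state S x0 w k ω - localEst S G g lstar Phat0 xhat0 (measurement S x0 w v ω) k i

variable {S μ x0 w v}

theorem estError_succ (G : Network N) (g : Gains N) (lstar : ℕ)
    (Phat0 : Fin N → Matrix (Fin n) (Fin n) ℝ) (xhat0 : Fin N → Fin n → ℝ) (k : ℕ) (ω : Ω) :
    estError S x0 w v G g lstar Phat0 xhat0 (k + 1) ω =
      correctLinear S G g (predictedCov S G g lstar Phat0 k) lstar
        (fun i => S.F *ᵥ estError S x0 w v G g lstar Phat0 xhat0 k ω i + w k ω,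
         fun i => -v i (k + 1) ω) := by
  funext i
  change state S x0 w (k + 1) ω - correct S G g (predictedCov S G g lstar Phat0 k) _ _ lstar i = _
  rw [sub_correct]
  refine congrFun (congrArg _ (Prod.ext (funext fun j => ?_) (funext fun j => ?_))) i
  · simp only [state, estError, Matrix.mulVec_sub]
    abel
  · simp [measurement]

theorem integrable_mulVec {p q : ℕ} (A : Matrix (Fin p) (Fin q) ℝ) {f : Ω → Fin q → ℝ}
    (hf : Integrable f μ) : Integrable (fun ω => A *ᵥ f ω) μ :=
  (LinearMap.toContinuousLinearMap A.mulVecLin).integrable_comp hf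

theorem integral_mulVec {p q : ℕ} (A : Matrix (Fin p) (Fin q) ℝ) {f : Ω → Fin q → ℝ}
    (hf : Integrable f μ) : ∫ ω, A *ᵥ f ω ∂μ = A *ᵥ ∫ ω, f ω ∂μ :=
  (LinearMap.toContinuousLinearMap A.mulVecLin).integral_comp_comm hf

/-- Integrability of the errors, and the recursion of their means. -/
theorem integrable_estError_and_mean (h : IsNoiseModel S μ P0 x0 w v) (G : Network N) (g : Gains N)
    (lstar : ℕ) (Phat0 : Fin N → Matrix (Fin n) (Fin n) ℝ) (xhat0 : Fin N → Fin n → ℝ) (k : ℕ) :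
    (∀ i, Integrable (fun ω => estError S x0 w v G g lstar Phat0 xhat0 k ω i) μ) ∧
    (fun i => ∫ ω, estError S x0 w v G g lstar Phat0 xhat0 (k + 1) ω i ∂μ) =
      correct S G g (predictedCov S G g lstar Phat0 k)
        (fun i => S.F *ᵥ ∫ ω, estError S x0 w v G g lstar Phat0 xhat0 k ω i ∂μ) 0 lstar := by
  set D := estError S x0 w v G g lstar Phat0 xhat0
  let A : ℕ → ((Fin N → Fin n → ℝ) × (∀ i, Fin (m i) → ℝ)) →L[ℝ] (Fin N → Fin n → ℝ) := fun k =>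
    LinearMap.toContinuousLinearMap (correctLinear S G g (predictedCov S G g lstar Phat0 k) lstar)
  let f : ℕ → Ω → (Fin N → Fin n → ℝ) := fun k ω i => S.F *ᵥ D k ω i + w k ω
  let y : ℕ → Ω → (∀ i, Fin (m i) → ℝ) := fun k ω i => -v i (k + 1) ω
  have hD : ∀ k ω, D (k + 1) ω = A k (f k ω, y k ω) := fun k ω => estError_succ _ _ _ _ _ _ _
  have hfi : ∀ k, (∀ i, Integrable (fun ω => D k ω i) μ) → ∀ i, Integrable (fun ω => f k ω i) μ :=
    fun k hk i => (integrable_mulVec S.F (hk i)).add (h.integrable_w k)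
  have hyi : ∀ k i, Integrable (fun ω => y k ω i) μ := fun k i => (h.integrable_v i (k + 1)).neg
  have hpair : ∀ k, (∀ i, Integrable (fun ω => D k ω i) μ) →
      Integrable (fun ω => (f k ω, y k ω)) μ := fun k hk =>
    (Integrable.of_eval (hfi k hk)).prodMk (Integrable.of_eval (hyi k))
  have hint : ∀ k i, Integrable (fun ω => D k ω i) μ := fun k => by
    induction k with
    | zero => exact fun i => h.gaussian_x0.integrable.sub (integrable_const (xhat0 i))
    | succ k ih =>
      intro i
      simp_rw [hD]
      exact ((A k).integrable_comp (hpair k ih)).eval i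
  refine ⟨hint k, ?_⟩
  have h1 : ∫ ω, D (k + 1) ω ∂μ = A k (∫ ω, f k ω ∂μ, ∫ ω, y k ω ∂μ) := by
    simp_rw [hD]
    rw [(A k).integral_comp_comm (hpair k (hint k)),
      integral_pair (Integrable.of_eval (hfi k (hint k))) (Integrable.of_eval (hyi k))]
  have h2 : ∫ ω, y k ω ∂μ = 0 := by
    funext i
    rw [MeasureTheory.eval_integral (hyi k)]
    simp only [y, integral_neg, h.integral_v, neg_zero, Pi.zero_apply]
  have h3 : ∫ ω, f k ω ∂μ = fun i => S.F *ᵥ ∫ ω, D k ω i ∂μ := by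
    funext i
    rw [MeasureTheory.eval_integral (hfi k (hint k))]
    simp only [f]
    rw [integral_add (integrable_mulVec S.F (hint k i)) (h.integrable_w k), h.integral_w,
      integral_mulVec S.F (hint k i), add_zero]
  have h4 : (fun i => ∫ ω, D (k + 1) ω i ∂μ) = ∫ ω, D (k + 1) ω ∂μ := by
    funext i
    rw [MeasureTheory.eval_integral (hint (k + 1))]
  rw [h4, h1, h2, h3]
  rfl

end MeanError

end DADKF

theorem mainTheorem2 {N n : ℕ} {m : Fin N → ℕ}
    (S : DADKF.LinSystem N n m) (hQ : S.Q.PosDef) (hR : ∀ i, (S.R i).PosDef)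
    (hobs : S.Observable)
    (G : DADKF.Network N) (hconn : G.graph.Connected)
    (sigmaBar : ℝ) (hsigma_pos : 0 < sigmaBar)
    (hsigma : ∀ s : ℝ, Module.End.HasEigenvalue (Matrix.toLin' G.laplacian) s → s ≤ sigmaBar)
    (g : DADKF.Gains N) (heps : ∀ i, 0 < g.eps i)
    (hlam : ∀ i, 0 < g.alphaLam i ∧ g.alphaLam i < 2 / sigmaBar ^ 2)
    (hups : ∀ i, 0 < g.alphaUps i ∧ g.alphaUps i < 2 / sigmaBar ^ 2) :
    ∃ lbar : ℕ, ∀ lstar : ℕ, lbar ≤ lstar →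
      ∀ (Phat0 : Fin N → Matrix (Fin n) (Fin n) ℝ) (xhat0 : Fin N → Fin n → ℝ),
        (∀ i, (Phat0 i).PosDef) →
        (∀ k i, (DADKF.localCov S G g lstar Phat0 k i).PosDef) ∧
        ∀ (Ω : Type*) [MeasurableSpace Ω] (μ : Measure Ω) [IsProbabilityMeasure μ]
          (P0 : Matrix (Fin n) (Fin n) ℝ) (x0 : Ω → Fin n → ℝ) (w : ℕ → Ω → Fin n → ℝ)
          (v : ∀ i, ℕ → Ω → Fin (m i) → ℝ),
          P0.PosDef → DADKF.IsNoiseModel S μ P0 x0 w v →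
          ∀ i : Fin N,
            (∀ k : ℕ, 1 ≤ k → Integrable (fun ω => DADKF.state S x0 w k ω -
              DADKF.xi S G g lstar Phat0 xhat0 (DADKF.measurement S x0 w v ω) i k lstar) μ) ∧
            Tendsto (fun k : ℕ => ∫ ω, (DADKF.state S x0 w k ω -
              DADKF.xi S G g lstar Phat0 xhat0 (DADKF.measurement S x0 w v ω) i k lstar) ∂μ)
              atTop (𝓝 0) := by
  obtain ⟨lbar, hlbar⟩ :=
    DADKF.exists_lbar_stable hQ hR hobs hconn hsigma_pos hsigma heps hlam hups
  refine ⟨lbar, fun lstar hl Phat0 xhat0 hP0 => ?_⟩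
  obtain ⟨hP, hstab⟩ := hlbar lstar hl Phat0 hP0
  refine ⟨hP, fun Ω _ μ _ P0 x0 w v _ hmodel i => ?_⟩
  have hmean := DADKF.integrable_estError_and_mean hmodel G g lstar Phat0 xhat0
  refine ⟨fun k hk => ?_, ?_⟩
  · obtain ⟨j, rfl⟩ : ∃ j, k = j + 1 := ⟨k - 1, by omega⟩
    exact (hmean (j + 1)).1 i
  · have h := hstab (fun k i => S.F *ᵥ
      ∫ ω, DADKF.estError S x0 w v G g lstar Phat0 xhat0 k ω i ∂μ) fun k => by
        rw [← (hmean k).2]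
    simp_rw [← (hmean _).2] at h
    exact (tendsto_add_atTop_iff_nat 1).mp (tendsto_pi_nhds.mp h i)
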